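/- Let $\Sigma$ be a smooth three-dimensional manifold, $I\subseteq\mathbb R$ an interval of positive length, and $h(t)$, $t\in I$, a family of Riemannian metrics on $\Sigma$ whose components $h_{ij}(t,x)$ depend smoothly on $(t,x)\in I\times\Sigma$. Let $a,N:I\to\mathbb R$ be smooth functions, which may vanish, such that $\{t\in I: a(t)\neq 0\}$ is dense in $I$ and $f=a/N$ is smooth, i.e. there is a smooth $f:I\to\mathbb R$ with $a=fN$ on $I$. On $M=I\times\Sigma$ consider the (possibly degenerate) metric $$g=ds^2=-N^2(t)\,dt^2+a^2(t)\,h_{ij}(t,x)\,dx^i\,dx^j .$$ **Definitions.** Let $$\mathcal K(X,Y,Z)=\tfrac12\{X\langle Y,Z\rangle+Y\langle Z,X\rangle-Z\langle X,Y\rangle-\langle X,[Y,Z]\rangle+\langle Y,[Z,X]\rangle+\langle Z,[X,Y]\rangle\}$$ be the Koszul form of a smooth symmetric, possibly degenerate, metric $g$. The metric is *semi-regular* if (1) $\mathcal K(X,Y,W)=0$ at $p$ for all local vector fields $X,Y$ and every $W\in T_pM$ with $\langle W,\cdot\rangle=0$; and (2) for all local vector fields $X,Y,Z,T$ the contraction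 $\mathcal K(X,Y,\bullet)\,\mathcal K(Z,T,\bullet)$, taken at the points around which the signature of $g$ is locally constant, extends to a smooth function. At the points where $g$ is nondegenerate put, with $n=\dim M$, $\Gamma_{abc}=\mathcal K(\partial_a,\partial_b,\partial_c)$, $$R_{abcd}=\partial_a\Gamma_{bcd}-\partial_b\Gamma_{acd}+\Gamma_{ac\bullet}\Gamma_{bd\bullet}-\Gamma_{bc\bullet}\Gamma_{ad\bullet},\quad R_{ab}=g^{st}R_{asbt},\quad R=g^{st}R_{st},\quad S_{ab}=R_{ab}-\tfrac1n R g_{ab},$$ $$S_{abcd}=\tfrac{1}{2n(n-1)}R\,(g\circ g)_{abcd},\quad E_{abcd}=\tfrac1{n-2}(S\circ g)_{abcd},\quad C_{abcd}=R_{abcd}-S_{abcd}-E_{abcd},$$ where $(h\circ k)_{abcd}=h_{ac}k_{bd}-h_{ad}k_{bc}+h_{bd}k_{ac}-h_{bc}k_{ad}$. The metric is *quasi-regular* if it is semi-regular, it is nondegenerate on a dense subset of $M$, and $S_{abcd}$ and $E_{abcd}$ extend smoothly from the nondegenerate points to all of $M$. **Theorem.** The metric $g$ on $I\times\Sigma$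 is quasi-regular; in particular, it is semi-regular, and the tensors $S_{abcd}$ and $E_{abcd}$ extend smoothly across the singularity $a=0$. The tensors $\mathrm{Ric}\circ g$ and $R\,g\circ g$ also extend smoothly to all of $I\times\Sigma$. Moreover the Weyl curvature tensor $C_{abcd}$ extends smoothly to all of $I\times\Sigma$, and its extension vanishes at all points $(t,x)$ with $N(t)=0$. -/

import Mathlib

open Set Filter
open scoped Manifold ContDiff Topology

noncomputable section

/-! ### Tensor calculus in a coordinate domain

`E` is the model vector space, `s : Set E` the coordinate domain (with unique differentials),
`G y` the metric at `y`, as a symmetric bilinear form that may be degenerate. A basis `b` of `E`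
gives the coordinate vector fields `∂ᵢ = b i`. -/

section Coordinates

variable {E : Type*} [NormedAddCommGroup E] [NormedSpace ℝ E]

/-- The bilinear form `B` is nondegenerate. -/
def NondegForm {V : Type*} [TopologicalSpace V] [AddCommGroup V] [Module ℝ V]
    (B : V →L[ℝ] V →L[ℝ] ℝ) : Prop :=
  ∀ v : V, (∀ w : V, B v w = 0) → v = 0

/-- The rank of a bilinear form. -/
def formRank (B : E →L[ℝ] E →L[ℝ] ℝ) : ℕ :=
  Module.finrank ℝ (LinearMap.range (B : E →ₗ[ℝ] E →L[ℝ] ℝ))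

/-- The Koszul object
`K(X,Y,Z) = ½ {X⟨Y,Z⟩ + Y⟨Z,X⟩ - Z⟨X,Y⟩ - ⟨X,[Y,Z]⟩ + ⟨Y,[Z,X]⟩ + ⟨Z,[X,Y]⟩}`
at the point `y`, all derivatives being taken within `s`. -/
def koszul (G : E → E →L[ℝ] E →L[ℝ] ℝ) (s : Set E) (X Y Z : E → E) (y : E) : ℝ :=
  (1 / 2) *
    (fderivWithin ℝ (fun z => G z (Y z) (Z z)) s y (X y)
      + fderivWithin ℝ (fun z => G z (Z z) (X z)) s y (Y y)
      - fderivWithin ℝ (fun z => G z (X z) (Y z)) s y (Z y)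
      - G y (X y) (VectorField.lieBracketWithin ℝ Y Z s y)
      + G y (Y y) (VectorField.lieBracketWithin ℝ Z X s y)
      + G y (Z y) (VectorField.lieBracketWithin ℝ X Y s y))

/-- The form `K(X,Y,·)` vanishes on the radical of the metric, for all local vector fields `X, Y`
(defined on `s ∩ U`, `U` open). As `K` is tensorial in its last argument, its value at `y` on a
vector `W` is computed with the constant extension of `W`. -/
def RadicalStationary (G : E → E →L[ℝ] E →L[ℝ] ℝ) (s : Set E) : Prop :=
  ∀ U : Set E, IsOpen U → ∀ X Y : E → E, ContDiffOn ℝ ∞ X (s ∩ U) → ContDiffOn ℝ ∞ Y (s ∩ U) →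
    ∀ y ∈ s ∩ U, ∀ W : E, (∀ v : E, G y W v = 0) →
      koszul G (s ∩ U) X Y (fun _ => W) y = 0

/-- The contraction `K(X,Y,•) K(Z,T,•)` is smooth for all local vector fields `X, Y, Z, T`.
The contraction of two covectors `ω = ⟨u,·⟩`, `τ = ⟨v,·⟩` is `⟨u,v⟩`. It is taken at the points
around which the signature of the metric is locally constant (the nondegenerate points, if these
are dense), and has to extend from there to a smooth function. -/
def SmoothKoszulContraction (G : E → E →L[ℝ] E →L[ℝ] ℝ) (s : Set E) : Prop :=
  ∀ U : Set E, IsOpen U → ∀ X Y Z T : E → E,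
    ContDiffOn ℝ ∞ X (s ∩ U) → ContDiffOn ℝ ∞ Y (s ∩ U) →
    ContDiffOn ℝ ∞ Z (s ∩ U) → ContDiffOn ℝ ∞ T (s ∩ U) →
    ∃ F : E → ℝ, ContDiffOn ℝ ∞ F (s ∩ U) ∧
      ∀ y ∈ s ∩ U, (∀ᶠ z in 𝓝[s] y, formRank (G z) = formRank (G y)) →
        ∀ u v : E, (∀ w : E, G y u w = koszul G (s ∩ U) X Y (fun _ => w) y) →
          (∀ w : E, G y v w = koszul G (s ∩ U) Z T (fun _ => w) y) →
          F y = G y u v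

variable {ι : Type*} [Fintype ι] [DecidableEq ι] (b : Module.Basis ι ℝ E)

/-- The components `g_{ij}` of the metric. -/
def metricComp (G : E → E →L[ℝ] E →L[ℝ] ℝ) (y : E) : Matrix ι ι ℝ :=
  Matrix.of fun i j => G y (b i) (b j)

/-- The components `g^{ij}` of the reciprocal metric (meaningful where `G` is nondegenerate). -/
def invMetricComp (G : E → E →L[ℝ] E →L[ℝ] ℝ) (y : E) : Matrix ι ι ℝ :=
  (metricComp b G y)⁻¹

/-- Christoffel's symbols of the first kind, `Γ_{ijk} = K(∂ᵢ, ∂ⱼ, ∂ₖ)`. -/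
def christoffel (G : E → E →L[ℝ] E →L[ℝ] ℝ) (s : Set E) (i j k : ι) (y : E) : ℝ :=
  koszul G s (fun _ => b i) (fun _ => b j) (fun _ => b k) y

/-- The Riemann curvature
`R_{ijkl} = ∂ᵢ Γ_{jkl} - ∂ⱼ Γ_{ikl} + Γ_{ik•} Γ_{jl•} - Γ_{jk•} Γ_{il•}`
(at nondegenerate points). -/
def riemann (G : E → E →L[ℝ] E →L[ℝ] ℝ) (s : Set E) (i j k l : ι) (y : E) : ℝ :=
  fderivWithin ℝ (christoffel b G s j k l) s y (b i)
    - fderivWithin ℝ (christoffel b G s i k l) s y (b j)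
    + ∑ p, ∑ q, invMetricComp b G y p q *
        (christoffel b G s i k p y * christoffel b G s j l q y
          - christoffel b G s j k p y * christoffel b G s i l q y)

/-- The Ricci curvature `R_{ij} = g^{pq} R_{ipjq}`. -/
def ricci (G : E → E →L[ℝ] E →L[ℝ] ℝ) (s : Set E) (i j : ι) (y : E) : ℝ :=
  ∑ p, ∑ q, invMetricComp b G y p q * riemann b G s i p j q y

/-- The scalar curvature `R = g^{pq} R_{pq}`. -/
def scalarCurv (G : E → E →L[ℝ] E →L[ℝ] ℝ) (s : Set E) (y : E) : ℝ :=
  ∑ p, ∑ q, invMetricComp b G y p q * ricci b G s p q y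

/-- The Kulkarni-Nomizu product of two bilinear forms, in components. -/
def kulkarniNomizu {κ : Type*} (h k : κ → κ → ℝ) (p q r t : κ) : ℝ :=
  h p r * k q t - h p t * k q r + h q t * k p r - h q r * k p t

/-- `Ric ∘ g`. -/
def ricciKN (G : E → E →L[ℝ] E →L[ℝ] ℝ) (s : Set E) (i j k l : ι) (y : E) : ℝ :=
  kulkarniNomizu (fun p q => ricci b G s p q y) (metricComp b G y) i j k l

/-- `R g ∘ g`. -/
def scalarKN (G : E → E →L[ℝ] E →L[ℝ] ℝ) (s : Set E) (i j k l : ι) (y : E) : ℝ :=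
  scalarCurv b G s y * kulkarniNomizu (metricComp b G y) (metricComp b G y) i j k l

/-- The traceless Ricci tensor `S_{ij} = R_{ij} - (1/n) R g_{ij}`, `n` being the dimension. -/
def tracelessRicci (G : E → E →L[ℝ] E →L[ℝ] ℝ) (s : Set E) (i j : ι) (y : E) : ℝ :=
  ricci b G s i j y - 1 / (Fintype.card ι : ℝ) * scalarCurv b G s y * metricComp b G y i j

/-- The scalar part of the curvature, `S_{ijkl} = 1 / (2n(n-1)) R (g ∘ g)_{ijkl}`. -/
def scalarPart (G : E → E →L[ℝ] E →L[ℝ] ℝ) (s : Set E) (i j k l : ι) (y : E) : ℝ :=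
  1 / (2 * (Fintype.card ι : ℝ) * ((Fintype.card ι : ℝ) - 1)) * scalarCurv b G s y *
    kulkarniNomizu (metricComp b G y) (metricComp b G y) i j k l

/-- The semi-traceless part of the curvature, `E_{ijkl} = 1 / (n-2) (S ∘ g)_{ijkl}`. -/
def semiTracelessPart (G : E → E →L[ℝ] E →L[ℝ] ℝ) (s : Set E) (i j k l : ι) (y : E) : ℝ :=
  1 / ((Fintype.card ι : ℝ) - 2) *
    kulkarniNomizu (fun p q => tracelessRicci b G s p q y) (metricComp b G y) i j k l

/-- The Weyl curvature `C_{ijkl} = R_{ijkl} - S_{ijkl} - E_{ijkl}`. -/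
def weyl (G : E → E →L[ℝ] E →L[ℝ] ℝ) (s : Set E) (i j k l : ι) (y : E) : ℝ :=
  riemann b G s i j k l y - scalarPart b G s i j k l y - semiTracelessPart b G s i j k l y

end Coordinates

/-! ### Degenerate metrics on manifolds

`M` is a manifold with model `J` on the vector space `E`, and `D` is a subset of `M` with unique
differentials (all of `M`, an open subset, or a product of `ℝ`-intervals of positive length with
manifolds), regarded as a manifold itself. -/

section Manifolds

variable {E : Type*} [NormedAddCommGroup E] [NormedSpace ℝ E]
  {H : Type*} [TopologicalSpace H] (J : ModelWithCorners ℝ E H)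
  {M : Type*} [TopologicalSpace M] [ChartedSpace H M]

/-- The image of `D` in the chart `e`. -/
def chartSet (e : OpenPartialHomeomorph M H) (D : Set M) : Set E :=
  (e.extend J).target ∩ (e.extend J).symm ⁻¹' D

/-- The expression in the chart `e` of a field `g` of bilinear forms on the tangent spaces: its
pull-back by the inverse of the chart. -/
def chartForm (e : OpenPartialHomeomorph M H)
    (g : ∀ p : M, TangentSpace J p →L[ℝ] TangentSpace J p →L[ℝ] ℝ) :
    E → E →L[ℝ] E →L[ℝ] ℝ := fun y =>
  let B : E →L[ℝ] E →L[ℝ] ℝ := g ((e.extend J).symm y)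
  let L : E →L[ℝ] E := mfderivWithin 𝓘(ℝ, E) J (e.extend J).symm (range J) y
  B.bilinearComp L L

/-- `g` is a smooth field of bilinear forms on `D`: smooth in every chart of the atlas. -/
def SmoothForm (D : Set M)
    (g : ∀ p : M, TangentSpace J p →L[ℝ] TangentSpace J p →L[ℝ] ℝ) : Prop :=
  ∀ e ∈ atlas H M, ContDiffOn ℝ ∞ (chartForm J e g) (chartSet J e D)

/-- `g` is a semi-regular metric on `D`: a smooth field of symmetric bilinear forms, possibly
degenerate and of variable signature, with `K(X,Y,·)` vanishing on the radical and
`K(X,Y,•) K(Z,T,•)` smooth. -/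
structure IsSemiRegular (D : Set M)
    (g : ∀ p : M, TangentSpace J p →L[ℝ] TangentSpace J p →L[ℝ] ℝ) : Prop where
  smooth : SmoothForm J D g
  symm : ∀ p ∈ D, ∀ v w : TangentSpace J p, g p v w = g p w v
  radicalStationary : ∀ e ∈ atlas H M, RadicalStationary (chartForm J e g) (chartSet J e D)
  smoothContraction : ∀ e ∈ atlas H M,
    SmoothKoszulContraction (chartForm J e g) (chartSet J e D)

variable {ι : Type*} (b : Module.Basis ι ℝ E)

/-- The tensor `T`, which is given at the nondegenerate points of `g` by its components
`T G s i j k l` in terms of the metric `G` in a chart with domain `s`, extends smoothly to `D`: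
in every chart of the atlas, each component extends to a smooth function. If the nondegenerate
points are dense, then the extensions are unique, and those in different charts
fit together to a tensor field. -/
def ExtendsSmoothly (D : Set M)
    (g : ∀ p : M, TangentSpace J p →L[ℝ] TangentSpace J p →L[ℝ] ℝ)
    (T : (E → E →L[ℝ] E →L[ℝ] ℝ) → Set E → ι → ι → ι → ι → E → ℝ) : Prop :=
  ∀ e ∈ atlas H M, ∀ i j k l : ι, ∃ F : E → ℝ, ContDiffOn ℝ ∞ F (chartSet J e D) ∧
    ∀ y ∈ chartSet J e D, NondegForm (chartForm J e g y) →
      F y = T (chartForm J e g) (chartSet J e D) i j k l y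

/-- As `ExtendsSmoothly`, and the extended tensor vanishes at the points of `Z`. -/
def ExtendsSmoothlyVanishingOn (D : Set M)
    (g : ∀ p : M, TangentSpace J p →L[ℝ] TangentSpace J p →L[ℝ] ℝ)
    (T : (E → E →L[ℝ] E →L[ℝ] ℝ) → Set E → ι → ι → ι → ι → E → ℝ) (Z : Set M) : Prop :=
  ∀ e ∈ atlas H M, ∀ i j k l : ι, ∃ F : E → ℝ, ContDiffOn ℝ ∞ F (chartSet J e D) ∧
    (∀ y ∈ chartSet J e D, NondegForm (chartForm J e g y) →
      F y = T (chartForm J e g) (chartSet J e D) i j k l y) ∧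
    ∀ y ∈ chartSet J e D, (e.extend J).symm y ∈ Z → F y = 0

/-- `g` is a quasi-regular metric on `D`. The basis `b` of the model vector space only fixes the
linear coordinates in which components are written. -/
structure IsQuasiRegular [Fintype ι] [DecidableEq ι] (D : Set M)
    (g : ∀ p : M, TangentSpace J p →L[ℝ] TangentSpace J p →L[ℝ] ℝ) : Prop where
  semiRegular : IsSemiRegular J D g
  dense : D ⊆ closure {p ∈ D | NondegForm (g p)}
  scalarPart_extends : ExtendsSmoothly J D g (scalarPart b)
  semiTracelessPart_extends : ExtendsSmoothly J D g (semiTracelessPart b)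

end Manifolds

/-! ### The cosmological metric -/

section Cosmology

/-- The model of `ℝ × S` for a three-dimensional manifold `S`. -/
abbrev spacetimeModel : ModelWithCorners ℝ (ℝ × EuclideanSpace ℝ (Fin 3))
    (ModelProd ℝ (EuclideanSpace ℝ (Fin 3))) :=
  𝓘(ℝ, ℝ).prod (𝓡 3)

/-- The standard basis `(∂₀; ∂₁, ∂₂, ∂₃)` of the model vector space of `ℝ × S`. -/
def spacetimeBasis : Module.Basis (Unit ⊕ Fin 3) ℝ (ℝ × EuclideanSpace ℝ (Fin 3)) :=
  (Module.Basis.singleton Unit ℝ).prod (EuclideanSpace.basisFun (Fin 3) ℝ).toBasis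

variable {S : Type*} [TopologicalSpace S] [ChartedSpace (EuclideanSpace ℝ (Fin 3)) S]

/-- The form `dσ_t² = h_{ij}(t,x) dxⁱ dxʲ` on `ℝ × S`, for a family `h t` of fields of bilinear
forms on `S`. -/
def spatialForm (h : ℝ → ∀ x : S, TangentSpace (𝓡 3) x →L[ℝ] TangentSpace (𝓡 3) x →L[ℝ] ℝ) :
    ∀ p : ℝ × S, TangentSpace spacetimeModel p →L[ℝ] TangentSpace spacetimeModel p →L[ℝ] ℝ :=
  fun p =>
    let B : EuclideanSpace ℝ (Fin 3) →L[ℝ] EuclideanSpace ℝ (Fin 3) →L[ℝ] ℝ := h p.1 p.2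
    let pr := ContinuousLinearMap.snd ℝ ℝ (EuclideanSpace ℝ (Fin 3))
    B.bilinearComp pr pr

/-- The form `dt²` on `ℝ × S`. -/
def timeForm : ∀ p : ℝ × S,
    TangentSpace spacetimeModel p →L[ℝ] TangentSpace spacetimeModel p →L[ℝ] ℝ :=
  fun _ =>
    let pr := ContinuousLinearMap.fst ℝ ℝ (EuclideanSpace ℝ (Fin 3))
    pr.smulRight pr

/-- The metric `ds² = -N²(t) dt² + a²(t) h_{ij}(t,x) dxⁱ dxʲ`. -/
def cosmologicalMetric (N a : ℝ → ℝ)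
    (h : ℝ → ∀ x : S, TangentSpace (𝓡 3) x →L[ℝ] TangentSpace (𝓡 3) x →L[ℝ] ℝ) :
    ∀ p : ℝ × S, TangentSpace spacetimeModel p →L[ℝ] TangentSpace spacetimeModel p →L[ℝ] ℝ :=
  fun p => (-(N p.1) ^ 2) • timeForm p + (a p.1) ^ 2 • spatialForm h p

/-- `h t`, `t ∈ I`, is a family of Riemannian metrics on `S`, depending smoothly on
`(t, x) ∈ I × S`. -/
structure IsRiemannianFamily (I : Set ℝ)
    (h : ℝ → ∀ x : S, TangentSpace (𝓡 3) x →L[ℝ] TangentSpace (𝓡 3) x →L[ℝ] ℝ) : Prop where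
  symm : ∀ t ∈ I, ∀ x : S, ∀ v w : TangentSpace (𝓡 3) x, h t x v w = h t x w v
  posDef : ∀ t ∈ I, ∀ x : S, ∀ v : TangentSpace (𝓡 3) x, v ≠ 0 → 0 < h t x v v
  smooth : SmoothForm spacetimeModel (I ×ˢ (univ : Set S)) (spatialForm h)

end Cosmology

end

/-!
In a product chart the metric is `g = -N² dt² + a² h_{ij} dxⁱ dxʲ` with `a = f N`, so all that is
needed can be computed explicitly and the powers of `N` and `a` counted.

*Semi-regularity.* For smooth fields `X`, `Y` the Koszul form factors as `K(X,Y,∂ₜ) = N p` and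
`K(X,Y,∂ᵢ) = a qᵢ` with `p` and `qᵢ` smooth (`IsWarpedOn.exists_koszul_factor`); for `p` this uses
`a a' = N f a'`. A vector `W` in the radical of `g` satisfies `N W⁰ = 0` and `a Wⁱ = 0`, so
`K(X,Y,W)` vanishes. At nondegenerate points the contraction of `(N p, a q)` with `(N p', a q')` is
`-p p' + h^{ij} qᵢ q'ⱼ`, which is smooth everywhere.

*Curvature.* Let `κ_{ij} = a' h_{ij} + ½ a ∂ₜh_{ij}`, so that `½ ∂ₜ(a² h_{ij}) = a κ_{ij}`. At the
nondegenerate points, with `A`, `ρ`, `ρ'`, `w` smooth up to `a = 0`,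
`R_{0i0j} = A_{ij}`, `R_{0ijk} = a ρ_{ijk}`, `R_{ij0k} = a ρ'_{ijk}`, `R_{ijkl} = f² w_{ijkl}`.
The last holds because the intrinsic part is `a² r_{ijkl} = f² N² r_{ijkl}`. Therefore
`R_{00} = a⁻² h^{pq} A_{pq}`, `R_{0i}` and `R_{i0}` are `a⁻¹` times smooth functions,
`R_{ij} = N⁻² V_{ij}` and `R = N⁻² a⁻² W` with `V` and `W` smooth. In the Kulkarni-Nomizu products
with `g` the singular terms `R_{00} g_{00}` and `R_{0i} g_{00}` only occur in components where they
cancel, and what remains has the same block form as the Riemann tensor, with the same weights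
`1`, `a`, `f²` (`blockTensor`). The tensors `S`, `E` and `C` are combinations of `Riem`, `Ric ∘ g` and `R g ∘ g`
with constant coefficients.

*The Weyl tensor where `N = 0`.* There `a = 0` and `a' = f N'`, so `κ = a' h`, `A = -a'² h` and
`w_{ijkl} = -a'² (h_{ik} h_{jl} - h_{jk} h_{il})`: these are pure trace, as for a homogeneous and
isotropic metric, and the blocks of the Weyl tensor cancel (`IsWarpedOn.weylExt_eq_zero`); the
`0ijk` block vanishes with its factor `a`.

*Charts.* Every chart of the atlas of `ℝ × S` is the product of the identity and a chart of `S`, and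
the derivative of its inverse is block diagonal and injective, so that the coordinate expression of
the metric has the form above (`isWarpedOn_chartForm`).
-/

noncomputable section

/-! ### The Koszul form, the rank, and the inverse matrix -/

section Koszul

variable {E : Type*} [NormedAddCommGroup E] [NormedSpace ℝ E]

/-- The Koszul form in terms of the flat derivatives of the metric and of the fields:
`K(X,Y,w) = ⟨D_X Y, w⟩ + ½ (D_X g(Y,w) + D_Y g(w,X) - D_w g(X,Y))`. -/
theorem koszul_eq_fderivWithin {G : E → E →L[ℝ] E →L[ℝ] ℝ} {s : Set E} {X Y : E → E} {y w : E}
    (hs : UniqueDiffWithinAt ℝ s y) (hG : DifferentiableWithinAt ℝ G s y)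
    (hX : DifferentiableWithinAt ℝ X s y) (hY : DifferentiableWithinAt ℝ Y s y)
    (hsymm : ∀ v w, G y v w = G y w v) :
    koszul G s X Y (fun _ => w) y = G y (fderivWithin ℝ Y s y (X y)) w
      + 1 / 2 * (fderivWithin ℝ G s y (X y) (Y y) w + fderivWithin ℝ G s y (Y y) w (X y)
        - fderivWithin ℝ G s y w (X y) (Y y)) := by
  have key : ∀ {U V : E → E}, DifferentiableWithinAt ℝ U s y → DifferentiableWithinAt ℝ V s y →
      ∀ z, fderivWithin ℝ (fun z => G z (U z) (V z)) s y z
        = fderivWithin ℝ G s y z (U y) (V y) + G y (fderivWithin ℝ U s y z) (V y)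
          + G y (U y) (fderivWithin ℝ V s y z) := by
    intro U V hU hV z
    rw [((hG.hasFDerivWithinAt.clm_apply hU.hasFDerivWithinAt).clm_apply
      hV.hasFDerivWithinAt).fderivWithin hs]
    simp
    ring
  have hc : DifferentiableWithinAt ℝ (fun _ : E => w) s y := differentiableWithinAt_const w
  rw [koszul, key hY hc, key hc hX, key hX hY]
  simp only [VectorField.lieBracketWithin, fderivWithin_fun_const,
    Pi.zero_apply, _root_.zero_apply, map_zero, zero_sub, sub_zero, map_neg, map_sub]
  rw [hsymm w (fderivWithin ℝ X s y (Y y)), hsymm w (fderivWithin ℝ Y s y (X y)),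
    hsymm (Y y) (fderivWithin ℝ X s y w)]
  ring

/-! The following lemmas have an arbitrary normed space `F` as target, and are used with `F` the space
of bilinear forms. -/

theorem ContDiffOn.smul_const_add_smul {F : Type*} [NormedAddCommGroup F] [NormedSpace ℝ F]
    {s : Set E} {φ ψ : E → ℝ} {B : E → F} (hφ : ContDiffOn ℝ ∞ φ s) (hψ : ContDiffOn ℝ ∞ ψ s)
    (hB : ContDiffOn ℝ ∞ B s) (τ : F) : ContDiffOn ℝ ∞ (fun y => φ y • τ + ψ y • B y) s :=
  (hφ.smul contDiffOn_const).add (hψ.smul hB)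

theorem fderivWithin_smul_const_add_smul {F : Type*} [NormedAddCommGroup F] [NormedSpace ℝ F]
    {s : Set E} {y : E} {φ ψ : E → ℝ} {φ' ψ' : E →L[ℝ] ℝ} {τ : F} {G B : E → F}
    (hs : UniqueDiffWithinAt ℝ s y) (hy : y ∈ s) (hG : ∀ y ∈ s, G y = φ y • τ + ψ y • B y)
    (hφ : HasFDerivWithinAt φ φ' s y) (hψ : HasFDerivWithinAt ψ ψ' s y)
    (hB : DifferentiableWithinAt ℝ B s y) (u : E) :
    fderivWithin ℝ G s y u = φ' u • τ + ψ' u • B y + ψ y • fderivWithin ℝ B s y u := by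
  rw [(((hφ.smul_const τ).add (hψ.smul hB.hasFDerivWithinAt)).congr hG (hG y hy)).fderivWithin hs]
  simp
  abel

theorem ContDiffOn.fderivWithin_apply_field {F : Type*} [NormedAddCommGroup F] [NormedSpace ℝ F]
    {s : Set E} {B : E → F} {X : E → E} (hs : UniqueDiffOn ℝ s) (hB : ContDiffOn ℝ ∞ B s)
    (hX : ContDiffOn ℝ ∞ X s) : ContDiffOn ℝ ∞ (fun y => fderivWithin ℝ B s y (X y)) s :=
  (hB.fderivWithin hs (by simp)).clm_apply hX

theorem fderivWithin_form_apply {s : Set E} {y : E} {B : E → E →L[ℝ] E →L[ℝ] ℝ}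
    (hs : UniqueDiffWithinAt ℝ s y) (hB : DifferentiableWithinAt ℝ B s y) (u v w : E) :
    fderivWithin ℝ (fun y => B y v w) s y u = fderivWithin ℝ B s y u v w := by
  rw [((hB.hasFDerivWithinAt.clm_apply (hasFDerivWithinAt_const v y s)).clm_apply
    (hasFDerivWithinAt_const w y s)).fderivWithin hs]
  simp

end Koszul

theorem nondegForm_iff_formRank {E : Type*} [NormedAddCommGroup E] [NormedSpace ℝ E]
    [FiniteDimensional ℝ E] (T : E →L[ℝ] E →L[ℝ] ℝ) :
    NondegForm T ↔ formRank T = Module.finrank ℝ E := by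
  have h := LinearMap.finrank_range_add_finrank_ker (T : E →ₗ[ℝ] E →L[ℝ] ℝ)
  have h2 : formRank T = Module.finrank ℝ E ↔ LinearMap.ker (T : E →ₗ[ℝ] E →L[ℝ] ℝ) = ⊥ := by
    rw [← Submodule.finrank_eq_zero (R := ℝ), formRank]
    omega
  rw [h2, LinearMap.ker_eq_bot']
  exact forall_congr' fun v => imp_congr_left
    ⟨fun h => ContinuousLinearMap.ext h, fun h w => by
      have := congrArg (fun T : E →L[ℝ] ℝ => T w) h
      simpa using this⟩

section MatrixInverse

variable {E : Type*} [NormedAddCommGroup E] [NormedSpace ℝ E] {n : Type*} [Fintype n]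
  [DecidableEq n] {s : Set E} {A : E → Matrix n n ℝ}

theorem ContDiffOn.matrix_det_of_entries (hA : ∀ i j, ContDiffOn ℝ ∞ (fun y => A y i j) s) :
    ContDiffOn ℝ ∞ (fun y => (A y).det) s := by
  simp only [Matrix.det_apply']
  exact ContDiffOn.sum fun σ _ => contDiffOn_const.mul (contDiffOn_prod fun i _ => hA _ _)

theorem ContDiffOn.matrix_inv_entry (hA : ∀ i j, ContDiffOn ℝ ∞ (fun y => A y i j) s)
    (hdet : ∀ y ∈ s, (A y).det ≠ 0) (i j : n) : ContDiffOn ℝ ∞ (fun y => (A y)⁻¹ i j) s := by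
  simp only [Matrix.inv_def, Matrix.smul_apply, Ring.inverse_eq_inv', smul_eq_mul,
    Matrix.adjugate_apply]
  refine ((ContDiffOn.matrix_det_of_entries hA).inv hdet).mul
    (ContDiffOn.matrix_det_of_entries fun k l => ?_)
  rcases eq_or_ne k j with rfl | hk
  · simpa only [Matrix.updateRow_self] using contDiffOn_const
  · simpa only [Matrix.updateRow_ne hk] using hA k l

end MatrixInverse

/-- The antisymmetry in the first pair of indices, which holds by the shape of the defining formula,
also where the metric degenerates. -/
theorem riemann_antisymm {E : Type*} [NormedAddCommGroup E] [NormedSpace ℝ E] {ι : Type*}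
    [Fintype ι] [DecidableEq ι] (b : Module.Basis ι ℝ E) (G : E → E →L[ℝ] E →L[ℝ] ℝ) (s : Set E)
    (i j k l : ι) (y : E) : riemann b G s i j k l y = -riemann b G s j i k l y := by
  have h : ∀ A A' : ι → ι → ℝ, ∑ p, ∑ q, invMetricComp b G y p q * (A p q - A' p q)
      = -∑ p, ∑ q, invMetricComp b G y p q * (A' p q - A p q) := by
    intro A A'
    simp only [← Finset.sum_neg_distrib]
    exact Finset.sum_congr rfl fun p _ => Finset.sum_congr rfl fun q _ => by ring
  rw [riemann, riemann, h]
  ring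

/-! ### Curvature-like tensors in block form -/

section BlockTensor

/-- The four-index array, antisymmetric under exchanging a time and a space index within either
pair, whose components are `u` of type `0i0j`, `c v` of type `0ijk`, `c v'` of type `ij0k` and `d w`
of type `ijkl`; components with two time indices in the same pair vanish. -/
def blockTensor (c d : ℝ) (u : Fin 3 → Fin 3 → ℝ) (v v' : Fin 3 → Fin 3 → Fin 3 → ℝ)
    (w : Fin 3 → Fin 3 → Fin 3 → Fin 3 → ℝ) :
    Unit ⊕ Fin 3 → Unit ⊕ Fin 3 → Unit ⊕ Fin 3 → Unit ⊕ Fin 3 → ℝ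
  | .inl _, .inr i, .inl _, .inr j => u i j
  | .inl _, .inr i, .inr j, .inl _ => -u i j
  | .inr i, .inl _, .inl _, .inr j => -u i j
  | .inr i, .inl _, .inr j, .inl _ => u i j
  | .inl _, .inr i, .inr j, .inr k => c * v i j k
  | .inr i, .inl _, .inr j, .inr k => -(c * v i j k)
  | .inr i, .inr j, .inl _, .inr k => c * v' i j k
  | .inr i, .inr j, .inr k, .inl _ => -(c * v' i j k)
  | .inr i, .inr j, .inr k, .inr l => d * w i j k l
  | _, _, _, _ => 0

theorem blockTensor_add_smul (c d r : ℝ) (u₁ u₂ : Fin 3 → Fin 3 → ℝ)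
    (v₁ v₂ v₁' v₂' : Fin 3 → Fin 3 → Fin 3 → ℝ) (w₁ w₂ : Fin 3 → Fin 3 → Fin 3 → Fin 3 → ℝ)
    (i j k l : Unit ⊕ Fin 3) :
    blockTensor c d u₁ v₁ v₁' w₁ i j k l + r * blockTensor c d u₂ v₂ v₂' w₂ i j k l
      = blockTensor c d (fun i j => u₁ i j + r * u₂ i j) (fun i j k => v₁ i j k + r * v₂ i j k)
          (fun i j k => v₁' i j k + r * v₂' i j k) (fun i j k l => w₁ i j k l + r * w₂ i j k l)
          i j k l := by
  rcases i with i | i <;> rcases j with j | j <;> rcases k with k | k <;> rcases l with l | l <;>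
    simp only [blockTensor] <;> ring

theorem blockTensor_eq_zero {d : ℝ} {u : Fin 3 → Fin 3 → ℝ}
    {v v' : Fin 3 → Fin 3 → Fin 3 → ℝ} {w : Fin 3 → Fin 3 → Fin 3 → Fin 3 → ℝ}
    (hu : ∀ i j, u i j = 0) (hw : ∀ i j k l, w i j k l = 0) (i j k l : Unit ⊕ Fin 3) :
    blockTensor 0 d u v v' w i j k l = 0 := by
  rcases i with i | i <;> rcases j with j | j <;> rcases k with k | k <;> rcases l with l | l <;>
    simp [blockTensor, hu, hw]

theorem contDiffOn_blockTensor {E : Type*} [NormedAddCommGroup E] [NormedSpace ℝ E] {s : Set E}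
    {c d : E → ℝ} {u : Fin 3 → Fin 3 → E → ℝ} {v v' : Fin 3 → Fin 3 → Fin 3 → E → ℝ}
    {w : Fin 3 → Fin 3 → Fin 3 → Fin 3 → E → ℝ} (hc : ContDiffOn ℝ ∞ c s)
    (hd : ContDiffOn ℝ ∞ d s) (hu : ∀ i j, ContDiffOn ℝ ∞ (u i j) s)
    (hv : ∀ i j k, ContDiffOn ℝ ∞ (v i j k) s) (hv' : ∀ i j k, ContDiffOn ℝ ∞ (v' i j k) s)
    (hw : ∀ i j k l, ContDiffOn ℝ ∞ (w i j k l) s) (i j k l : Unit ⊕ Fin 3) :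
    ContDiffOn ℝ ∞ (fun y => blockTensor (c y) (d y) (fun i j => u i j y)
      (fun i j k => v i j k y) (fun i j k => v' i j k y) (fun i j k l => w i j k l y) i j k l)
      s := by
  rcases i with i | i <;> rcases j with j | j <;> rcases k with k | k <;> rcases l with l | l <;>
    simp only [blockTensor] <;>
    first
      | exact contDiffOn_const
      | exact hu _ _
      | exact (hu _ _).neg
      | exact hc.mul (hv _ _ _)
      | exact (hc.mul (hv _ _ _)).neg
      | exact hc.mul (hv' _ _ _)
      | exact (hc.mul (hv' _ _ _)).neg
      | exact hd.mul (hw _ _ _ _)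

end BlockTensor

/-! ### Warped metrics in a coordinate domain -/

/-- The model vector space of the spacetime, whose first factor is the time. -/
local notation "E₄" => ℝ × EuclideanSpace ℝ (Fin 3)

section Warped

/-- The metric `G` has the form `-N² dt² + a² B` on the coordinate domain `s ⊆ I × ℝ³`, where
`a = f N` and `B` is a smooth field of forms that are positive definite on the spatial vectors and
have `∂ₜ` in the radical. Nothing is required of `G` and `B` outside `s`, since all derivatives are
taken within `s`. -/
structure IsWarpedOn (s : Set E₄) (I : Set ℝ) (N a f : ℝ → ℝ)
    (G B : E₄ → E₄ →L[ℝ] E₄ →L[ℝ] ℝ) : Prop where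
  uniqueDiffOn : UniqueDiffOn ℝ s
  uniqueDiffOn_time : UniqueDiffOn ℝ I
  fst_mem : ∀ y ∈ s, y.1 ∈ I
  contDiffOn_a : ContDiffOn ℝ ∞ a I
  contDiffOn_N : ContDiffOn ℝ ∞ N I
  contDiffOn_f : ContDiffOn ℝ ∞ f I
  a_eq : ∀ t ∈ I, a t = f t * N t
  contDiffOn_B : ContDiffOn ℝ ∞ B s
  B_symm : ∀ y ∈ s, ∀ v w, B y v w = B y w v
  B_time : ∀ y ∈ s, ∀ w, B y (1, 0) w = 0
  B_pos : ∀ y ∈ s, ∀ v : E₄, v.2 ≠ 0 → 0 < B y v v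
  G_eq : ∀ y ∈ s, G y = (-(N y.1) ^ 2) • (ContinuousLinearMap.fst ℝ ℝ
      (EuclideanSpace ℝ (Fin 3))).smulRight (ContinuousLinearMap.fst ℝ ℝ
      (EuclideanSpace ℝ (Fin 3))) + (a y.1) ^ 2 • B y

variable {s : Set E₄} {I : Set ℝ} {N a f : ℝ → ℝ} {G B : E₄ → E₄ →L[ℝ] E₄ →L[ℝ] ℝ} {y : E₄}

theorem spacetimeBasis_inl (i : Unit) : spacetimeBasis (Sum.inl i) = (1, 0) := by
  simp [spacetimeBasis]

theorem spacetimeBasis_inr (i : Fin 3) :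
    spacetimeBasis (Sum.inr i) = (0, EuclideanSpace.single i 1) := by
  simp [spacetimeBasis]

namespace IsWarpedOn

theorem inter (H : IsWarpedOn s I N a f G B) {U : Set E₄} (hU : IsOpen U) :
    IsWarpedOn (s ∩ U) I N a f G B where
  uniqueDiffOn := H.uniqueDiffOn.inter hU
  uniqueDiffOn_time := H.uniqueDiffOn_time
  fst_mem y hy := H.fst_mem y hy.1
  contDiffOn_a := H.contDiffOn_a
  contDiffOn_N := H.contDiffOn_N
  contDiffOn_f := H.contDiffOn_f
  a_eq := H.a_eq
  contDiffOn_B := H.contDiffOn_B.mono inter_subset_left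
  B_symm y hy := H.B_symm y hy.1
  B_time y hy := H.B_time y hy.1
  B_pos y hy := H.B_pos y hy.1
  G_eq y hy := H.G_eq y hy.1

theorem contDiffOn_comp_fst (H : IsWarpedOn s I N a f G B) {φ : ℝ → ℝ} (hφ : ContDiffOn ℝ ∞ φ I) :
    ContDiffOn ℝ ∞ (fun y => φ y.1) s :=
  hφ.comp contDiff_fst.contDiffOn H.fst_mem

theorem contDiffOn_derivWithin (H : IsWarpedOn s I N a f G B) {φ : ℝ → ℝ}
    (hφ : ContDiffOn ℝ ∞ φ I) : ContDiffOn ℝ ∞ (derivWithin φ I) I :=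
  hφ.derivWithin H.uniqueDiffOn_time (by simp)

theorem hasFDerivWithinAt_comp_fst (H : IsWarpedOn s I N a f G B) {φ : ℝ → ℝ}
    (hφ : ContDiffOn ℝ ∞ φ I) (hy : y ∈ s) :
    HasFDerivWithinAt (fun y => φ y.1) (derivWithin φ I y.1 •
      ContinuousLinearMap.fst ℝ ℝ (EuclideanSpace ℝ (Fin 3))) s y :=
  ((hφ.differentiableOn (by simp)) y.1 (H.fst_mem y hy)).hasDerivWithinAt.comp_hasFDerivWithinAt
    y hasFDerivWithinAt_fst H.fst_mem

theorem fderivWithin_comp_fst (H : IsWarpedOn s I N a f G B) {φ : ℝ → ℝ}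
    (hφ : ContDiffOn ℝ ∞ φ I) (hy : y ∈ s) (v : E₄) :
    fderivWithin ℝ (fun y => φ y.1) s y v = derivWithin φ I y.1 * v.1 := by
  rw [(H.hasFDerivWithinAt_comp_fst hφ hy).fderivWithin (H.uniqueDiffOn y hy)]
  simp

theorem derivWithin_a (H : IsWarpedOn s I N a f G B) {t : ℝ} (ht : t ∈ I) :
    derivWithin a I t = derivWithin f I t * N t + f t * derivWithin N I t := by
  rw [derivWithin_congr H.a_eq (H.a_eq t ht)]
  exact derivWithin_fun_mul ((H.contDiffOn_f.differentiableOn (by simp)) t ht)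
    ((H.contDiffOn_N.differentiableOn (by simp)) t ht)

theorem G_apply (H : IsWarpedOn s I N a f G B) (hy : y ∈ s) (v w : E₄) :
    G y v w = -(N y.1) ^ 2 * (v.1 * w.1) + (a y.1) ^ 2 * B y v w := by
  rw [H.G_eq y hy]
  simp

theorem contDiffOn_G (H : IsWarpedOn s I N a f G B) : ContDiffOn ℝ ∞ G s := by
  refine ContDiffOn.congr ?_ H.G_eq
  exact ((H.contDiffOn_comp_fst H.contDiffOn_N).pow 2).neg.smul_const_add_smul
    ((H.contDiffOn_comp_fst H.contDiffOn_a).pow 2) H.contDiffOn_B _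

theorem differentiableWithinAt_B (H : IsWarpedOn s I N a f G B) (hy : y ∈ s) :
    DifferentiableWithinAt ℝ B s y :=
  H.contDiffOn_B.differentiableOn (by simp) y hy

theorem G_symm (H : IsWarpedOn s I N a f G B) (hy : y ∈ s) (v w : E₄) :
    G y v w = G y w v := by
  rw [H.G_apply hy, H.G_apply hy, H.B_symm y hy v w, mul_comm v.1]

theorem fderivWithin_G (H : IsWarpedOn s I N a f G B) (hy : y ∈ s) (u v w : E₄) :
    fderivWithin ℝ G s y u v w = -2 * N y.1 * derivWithin N I y.1 * (u.1 * v.1 * w.1)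
      + 2 * a y.1 * derivWithin a I y.1 * u.1 * B y v w
      + (a y.1) ^ 2 * fderivWithin ℝ B s y u v w := by
  refine (congrArg (fun T : E₄ →L[ℝ] E₄ →L[ℝ] ℝ => T v w)
    (fderivWithin_smul_const_add_smul (H.uniqueDiffOn y hy) hy H.G_eq
      ((H.hasFDerivWithinAt_comp_fst H.contDiffOn_N hy).pow 2).neg
      ((H.hasFDerivWithinAt_comp_fst H.contDiffOn_a hy).pow 2)
      (H.differentiableWithinAt_B hy) u)).trans ?_
  simp
  ring

theorem fderivWithin_B_symm (H : IsWarpedOn s I N a f G B) (hy : y ∈ s) (u v w : E₄) :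
    fderivWithin ℝ B s y u v w = fderivWithin ℝ B s y u w v := by
  rw [← fderivWithin_form_apply (H.uniqueDiffOn y hy) (H.differentiableWithinAt_B hy),
    ← fderivWithin_form_apply (H.uniqueDiffOn y hy) (H.differentiableWithinAt_B hy)]
  exact congrArg (fun T : E₄ →L[ℝ] ℝ => T u)
    (fderivWithin_congr (fun z hz => H.B_symm z hz v w) (H.B_symm y hy v w))

theorem fderivWithin_B_time (H : IsWarpedOn s I N a f G B) (hy : y ∈ s)
    (u w : E₄) : fderivWithin ℝ B s y u (1, 0) w = 0 := by
  rw [← fderivWithin_form_apply (H.uniqueDiffOn y hy) (H.differentiableWithinAt_B hy),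
    fderivWithin_congr (fun z hz => H.B_time z hz w) (H.B_time y hy w)]
  simp

theorem koszul_eq (H : IsWarpedOn s I N a f G B) (hy : y ∈ s)
    {X Y : E₄ → E₄} (hX : ContDiffOn ℝ ∞ X s) (hY : ContDiffOn ℝ ∞ Y s) (w : E₄) :
    koszul G s X Y (fun _ => w) y =
      -(N y.1) ^ 2 * ((fderivWithin ℝ Y s y (X y)).1 * w.1)
      + (a y.1) ^ 2 * B y (fderivWithin ℝ Y s y (X y)) w
      - N y.1 * derivWithin N I y.1 * ((X y).1 * (Y y).1 * w.1)
      + a y.1 * derivWithin a I y.1 *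
        ((X y).1 * B y (Y y) w + (Y y).1 * B y (X y) w - w.1 * B y (X y) (Y y))
      + (a y.1) ^ 2 / 2 * (fderivWithin ℝ B s y (X y) (Y y) w
        + fderivWithin ℝ B s y (Y y) w (X y) - fderivWithin ℝ B s y w (X y) (Y y)) := by
  rw [koszul_eq_fderivWithin (H.uniqueDiffOn y hy) (H.contDiffOn_G.differentiableOn (by simp) y hy)
    (hX.differentiableOn (by simp) y hy) (hY.differentiableOn (by simp) y hy) (H.G_symm hy),
    H.fderivWithin_G hy, H.fderivWithin_G hy, H.fderivWithin_G hy, H.G_apply hy,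
    H.B_symm y hy w (X y)]
  ring

end IsWarpedOn

/-! ### Spatial components and semi-regularity -/

/-- The components `h_{ij}` of the form `B` at `y` on the spatial coordinate vectors. -/
def spatialGram (B : E₄ → E₄ →L[ℝ] E₄ →L[ℝ] ℝ) (y : E₄) : Matrix (Fin 3) (Fin 3) ℝ :=
  Matrix.of fun i j => B y (spacetimeBasis (Sum.inr i)) (spacetimeBasis (Sum.inr j))

theorem eq_time_add_spatial (w : E₄) :
    w = w.1 • ((1, 0) : E₄) + ∑ i, w.2 i • spacetimeBasis (Sum.inr i) := by
  refine Prod.ext ?_ (PiLp.ext fun j => ?_)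
  · simp [spacetimeBasis_inr, Prod.fst_sum]
  · simp [spacetimeBasis_inr, Fin.sum_univ_three]
    fin_cases j <;> simp

/-- Expansion of a linear functional along the coordinate vectors. -/
theorem clm_apply_eq_sum (T : E₄ →L[ℝ] ℝ) (w : E₄) :
    T w = w.1 * T (1, 0) + ∑ i, w.2 i * T (spacetimeBasis (Sum.inr i)) := by
  conv_lhs => rw [eq_time_add_spatial w]
  simp only [map_add, map_sum, map_smul, smul_eq_mul]

namespace IsWarpedOn

theorem B_apply_eq_sum (H : IsWarpedOn s I N a f G B) (hy : y ∈ s) (v w : E₄) :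
    B y v w = ∑ i, w.2 i * B y v (spacetimeBasis (Sum.inr i)) := by
  rw [clm_apply_eq_sum (B y v) w, H.B_symm y hy v (1, 0), H.B_time y hy, mul_zero, zero_add]

theorem spatialGram_mulVec (H : IsWarpedOn s I N a f G B) (hy : y ∈ s) (v : E₄) :
    (spatialGram B y).mulVec v.2 = fun i => B y v (spacetimeBasis (Sum.inr i)) := by
  ext i
  rw [H.B_symm y hy, H.B_apply_eq_sum hy]
  simp [spatialGram, Matrix.mulVec, dotProduct, mul_comm]

theorem spatialGram_symm (H : IsWarpedOn s I N a f G B) (hy : y ∈ s) :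
    (spatialGram B y).transpose = spatialGram B y := by
  ext i j
  exact H.B_symm y hy _ _

theorem det_spatialGram_ne_zero (H : IsWarpedOn s I N a f G B) (hy : y ∈ s) :
    (spatialGram B y).det ≠ 0 := by
  intro h0
  obtain ⟨v, hv, hv0⟩ := Matrix.exists_mulVec_eq_zero_iff.mpr h0
  have hv' : (WithLp.toLp 2 v : EuclideanSpace ℝ (Fin 3)) ≠ 0 := by simpa using hv
  have h1 := H.spatialGram_mulVec hy (0, WithLp.toLp 2 v)
  have h2 := H.B_pos y hy (0, WithLp.toLp 2 v) hv'
  rw [H.B_apply_eq_sum hy] at h2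
  have h3 : ∀ i, B y (0, WithLp.toLp 2 v) (spacetimeBasis (Sum.inr i)) = 0 := fun i =>
    (congrFun h1 i).symm.trans (congrFun hv0 i)
  simp [h3] at h2

theorem isUnit_det_spatialGram (H : IsWarpedOn s I N a f G B) (hy : y ∈ s) :
    IsUnit (spatialGram B y).det :=
  (H.det_spatialGram_ne_zero hy).isUnit

theorem spatialGram_inv_symm (H : IsWarpedOn s I N a f G B) (hy : y ∈ s) (i j : Fin 3) :
    (spatialGram B y)⁻¹ i j = (spatialGram B y)⁻¹ j i := by
  have h := Matrix.transpose_nonsing_inv (spatialGram B y)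
  rw [H.spatialGram_symm hy] at h
  exact congrFun (congrFun h j) i

theorem contDiffOn_spatialGram (H : IsWarpedOn s I N a f G B) (i j : Fin 3) :
    ContDiffOn ℝ ∞ (fun y => spatialGram B y i j) s :=
  (H.contDiffOn_B.clm_apply contDiffOn_const).clm_apply contDiffOn_const

theorem contDiffOn_spatialGram_inv (H : IsWarpedOn s I N a f G B) (i j : Fin 3) :
    ContDiffOn ℝ ∞ (fun y => (spatialGram B y)⁻¹ i j) s :=
  ContDiffOn.matrix_inv_entry H.contDiffOn_spatialGram
    (fun _ hy => H.det_spatialGram_ne_zero hy) i j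

/-- The reciprocal spatial metric contracts the covectors `B u` and `B v` to `B u v`. -/
theorem sum_spatialGram_inv (H : IsWarpedOn s I N a f G B) (hy : y ∈ s) (u v : E₄) :
    ∑ i, ∑ j, (spatialGram B y)⁻¹ i j * (B y u (spacetimeBasis (Sum.inr i))
      * B y v (spacetimeBasis (Sum.inr j))) = B y u v := by
  have h := congrArg ((spatialGram B y)⁻¹).mulVec (H.spatialGram_mulVec hy v)
  rw [Matrix.mulVec_mulVec, Matrix.nonsing_inv_mul _ (H.isUnit_det_spatialGram hy),
    Matrix.one_mulVec] at h
  rw [H.B_apply_eq_sum hy u v]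
  refine Finset.sum_congr rfl fun i _ => ?_
  rw [h]
  simp only [Matrix.mulVec, dotProduct, Finset.sum_mul]
  exact Finset.sum_congr rfl fun j _ => by ring

theorem N_ne_zero (H : IsWarpedOn s I N a f G B) (hy : y ∈ s) (ha : a y.1 ≠ 0) : N y.1 ≠ 0 :=
  fun h0 => ha (by rw [H.a_eq _ (H.fst_mem y hy), h0, mul_zero])

/-- Where `a` vanishes the spatial vectors are in the radical; where it does not, neither does `N`. -/
theorem nondegForm_iff (H : IsWarpedOn s I N a f G B) (hy : y ∈ s) :
    NondegForm (G y) ↔ a y.1 ≠ 0 := by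
  constructor
  · intro h h0
    have h1 := h (spacetimeBasis (Sum.inr 0)) fun w => by
      rw [H.G_apply hy, h0, spacetimeBasis_inr]
      simp
    exact spacetimeBasis.ne_zero _ h1
  · intro ha v hv
    have hN := H.N_ne_zero hy ha
    have h1 : v.1 = 0 := by
      have h := hv (1, 0)
      rw [H.G_apply hy, H.B_symm y hy, H.B_time y hy] at h
      simpa [hN] using h
    have h2 : v.2 = 0 := by
      by_contra hne
      have h := hv v
      rw [H.G_apply hy, h1] at h
      have := H.B_pos y hy v hne
      simp [ha, this.ne'] at h
    exact Prod.ext h1 h2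

/-- The Koszul form of smooth fields is divisible by `N` in the time direction and by `a` in the
spatial directions. -/
theorem exists_koszul_factor (H : IsWarpedOn s I N a f G B)
    {X Y : E₄ → E₄} (hX : ContDiffOn ℝ ∞ X s) (hY : ContDiffOn ℝ ∞ Y s) :
    ∃ (p : E₄ → ℝ) (q : Fin 3 → E₄ → ℝ),
      ContDiffOn ℝ ∞ p s ∧ (∀ i, ContDiffOn ℝ ∞ (q i) s) ∧ ∀ y ∈ s, ∀ w,
        koszul G s X Y (fun _ => w) y
          = N y.1 * (p y * w.1) + a y.1 * ∑ i, w.2 i * q i y := by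
  have hN := H.contDiffOn_comp_fst H.contDiffOn_N
  have ha := H.contDiffOn_comp_fst H.contDiffOn_a
  have hf := H.contDiffOn_comp_fst H.contDiffOn_f
  have hN' := H.contDiffOn_comp_fst (H.contDiffOn_derivWithin H.contDiffOn_N)
  have ha' := H.contDiffOn_comp_fst (H.contDiffOn_derivWithin H.contDiffOn_a)
  have hB := H.contDiffOn_B
  have hDB := fun {Z} hZ => ContDiffOn.fderivWithin_apply_field (X := Z) H.uniqueDiffOn hB hZ
  have hDY := ContDiffOn.fderivWithin_apply_field H.uniqueDiffOn hY hX
  have hc : ∀ w : E₄, ContDiffOn ℝ ∞ (fun _ => w) s := fun w => contDiffOn_const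
  -- `a = N f` makes the terms of `K(X,Y,∂ₜ)` with a factor `a` divisible by `N`
  refine ⟨fun y => -N y.1 * (fderivWithin ℝ Y s y (X y)).1
      - derivWithin N I y.1 * ((X y).1 * (Y y).1) - f y.1 * derivWithin a I y.1 * B y (X y) (Y y)
      - f y.1 * a y.1 * (1 / 2) * fderivWithin ℝ B s y (1, 0) (X y) (Y y),
    fun i y => a y.1 * B y (fderivWithin ℝ Y s y (X y)) (spacetimeBasis (Sum.inr i))
      + derivWithin a I y.1 * ((X y).1 * B y (Y y) (spacetimeBasis (Sum.inr i))
        + (Y y).1 * B y (X y) (spacetimeBasis (Sum.inr i)))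
      + a y.1 * (1 / 2) * (fderivWithin ℝ B s y (X y) (Y y) (spacetimeBasis (Sum.inr i))
        + fderivWithin ℝ B s y (Y y) (X y) (spacetimeBasis (Sum.inr i))
        - fderivWithin ℝ B s y (spacetimeBasis (Sum.inr i)) (X y) (Y y)), ?_, fun i => ?_, ?_⟩
  · exact (((hN.neg.mul hDY.fst).sub (hN'.mul (hX.fst.mul hY.fst))).sub
      ((hf.mul ha').mul ((hB.clm_apply hX).clm_apply hY))).sub
      (((hf.mul ha).mul contDiffOn_const).mul (((hDB (hc _)).clm_apply hX).clm_apply hY))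
  · exact ((ha.mul ((hB.clm_apply hDY).clm_apply (hc _))).add
      (ha'.mul ((hX.fst.mul ((hB.clm_apply hY).clm_apply (hc _))).add
        (hY.fst.mul ((hB.clm_apply hX).clm_apply (hc _)))))).add
      ((ha.mul contDiffOn_const).mul (((((hDB hX).clm_apply hY).clm_apply (hc _)).add
        (((hDB hY).clm_apply hX).clm_apply (hc _))).sub
        (((hDB (hc _)).clm_apply hX).clm_apply hY)))
  · intro y hy w
    have hDw : fderivWithin ℝ B s y w (X y) (Y y)
        = w.1 * fderivWithin ℝ B s y (1, 0) (X y) (Y y)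
          + ∑ i, w.2 i * fderivWithin ℝ B s y (spacetimeBasis (Sum.inr i)) (X y) (Y y) := by
      conv_lhs => rw [eq_time_add_spatial w]
      simp [-Prod.smul_mk]
    have hDv : ∀ u v, fderivWithin ℝ B s y u v w
        = ∑ i, w.2 i * fderivWithin ℝ B s y u v (spacetimeBasis (Sum.inr i)) := by
      intro u v
      rw [clm_apply_eq_sum (fderivWithin ℝ B s y u v) w, H.fderivWithin_B_symm hy u v (1, 0),
        H.fderivWithin_B_time hy, mul_zero, zero_add]
    rw [H.koszul_eq hy hX hY, H.fderivWithin_B_symm hy (Y y) w, hDv, hDv, hDw,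
      H.B_apply_eq_sum hy (fderivWithin ℝ Y s y (X y)) w, H.B_apply_eq_sum hy (Y y) w,
      H.B_apply_eq_sum hy (X y) w]
    have hfa := H.a_eq y.1 (H.fst_mem y hy)
    simp only [Fin.sum_univ_three]
    linear_combination (-derivWithin a I y.1 * w.1 * B y (X y) (Y y)
      - a y.1 / 2 * w.1 * fderivWithin ℝ B s y (1, 0) (X y) (Y y)) * hfa

/-- A vector `W` in the radical satisfies `N W⁰ = 0` and `a Wⁱ = 0`, and `K(X,Y,W)` is a combination
of these products. -/
theorem radicalStationary (H : IsWarpedOn s I N a f G B) : RadicalStationary G s := by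
  intro U hU X Y hX hY y hy W hW
  obtain ⟨p, q, -, -, hpq⟩ := (H.inter hU).exists_koszul_factor hX hY
  have h0 : N y.1 * W.1 = 0 := by
    have h := hW (1, 0)
    rw [H.G_apply hy.1, H.B_symm y hy.1, H.B_time y hy.1] at h
    simpa using h
  have h1 : ∀ i, a y.1 * W.2 i = 0 := by
    intro i
    rcases eq_or_ne W.2 0 with h2 | h2
    · simp [h2]
    · have h := hW W
      rw [H.G_apply hy.1] at h
      have hz : N y.1 ^ 2 * (W.1 * W.1) = 0 := by
        linear_combination (N y.1 * W.1) * h0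
      have ha : a y.1 ^ 2 * B y W W = 0 := by linear_combination h + hz
      have : a y.1 = 0 := by simpa [(H.B_pos y hy.1 W h2).ne'] using ha
      simp [this]
  rw [hpq y hy, Finset.mul_sum, Finset.sum_eq_zero fun i _ => by linear_combination q i y * h1 i]
  linear_combination p y * h0

end IsWarpedOn

/-- With `K(X,Y,·) = (N p, a q)` and `K(Z,T,·) = (N p', a q')` the contraction is
`-p p' + h^{ij} q_i q'_j`. -/
theorem IsWarpedOn.smoothKoszulContraction (H : IsWarpedOn s I N a f G B)
    (hd : s ⊆ closure {y ∈ s | a y.1 ≠ 0}) : SmoothKoszulContraction G s := by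
  intro U hU X Y Z T hX hY hZ hT
  obtain ⟨p, q, hp, hq, hpq⟩ := (H.inter hU).exists_koszul_factor hX hY
  obtain ⟨p', q', hp', hq', hpq'⟩ := (H.inter hU).exists_koszul_factor hZ hT
  refine ⟨fun y => -(p y * p' y) + ∑ i, ∑ j, (spatialGram B y)⁻¹ i j * (q i y * q' j y),
    (hp.mul hp').neg.add (ContDiffOn.sum fun i _ => ContDiffOn.sum fun j _ =>
      ((H.inter hU).contDiffOn_spatialGram_inv i j).mul ((hq i).mul (hq' j))), ?_⟩
  intro y hy hrank u v hu hv
  -- the rank is locally constant and maximal on a dense set, so it is maximal at `y`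
  have ha : a y.1 ≠ 0 := by
    have hfreq : ∃ᶠ z in 𝓝[s] y, a z.1 ≠ 0 := by
      rw [frequently_nhdsWithin_iff]
      exact (mem_closure_iff_frequently.mp (hd hy.1)).mono fun z hz => ⟨hz.2, hz.1⟩
    obtain ⟨z, hz, hzr, hzs⟩ := (hfreq.and_eventually
      (hrank.and eventually_mem_nhdsWithin)).exists
    rw [← H.nondegForm_iff hy.1, nondegForm_iff_formRank, ← hzr, ← nondegForm_iff_formRank,
      H.nondegForm_iff hzs]
    exact hz
  have hN := H.N_ne_zero hy.1 ha
  have time : ∀ {u : E₄} {p : ℝ} {q : Fin 3 → ℝ},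
      (∀ w, G y u w = N y.1 * (p * w.1) + a y.1 * ∑ i, w.2 i * q i) → p = -N y.1 * u.1 := by
    intro u p q h
    have h1 := h (1, 0)
    rw [H.G_apply hy.1, H.B_symm y hy.1, H.B_time y hy.1] at h1
    refine mul_left_cancel₀ hN ?_
    simp at h1
    linear_combination -h1
  have space : ∀ {u : E₄} {p : ℝ} {q : Fin 3 → ℝ},
      (∀ w, G y u w = N y.1 * (p * w.1) + a y.1 * ∑ i, w.2 i * q i) →
      ∀ i, q i = a y.1 * B y u (spacetimeBasis (Sum.inr i)) := by
    intro u p q h i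
    have h1 := h (spacetimeBasis (Sum.inr i))
    rw [H.G_apply hy.1] at h1
    refine mul_left_cancel₀ ha ?_
    simp only [spacetimeBasis_inr, PiLp.single_apply, ite_mul, one_mul, zero_mul,
      Finset.sum_ite_eq', Finset.mem_univ, if_true, mul_zero, zero_add] at h1 ⊢
    linear_combination -h1
  have hu' := fun w => (hu w).trans (hpq y hy w)
  have hv' := fun w => (hv w).trans (hpq' y hy w)
  have e : ∑ i, ∑ j, (spatialGram B y)⁻¹ i j * (q i y * q' j y)
      = a y.1 ^ 2 * B y u v := by
    rw [← H.sum_spatialGram_inv hy.1, Finset.mul_sum]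
    refine Finset.sum_congr rfl fun i _ => ?_
    rw [Finset.mul_sum]
    refine Finset.sum_congr rfl fun j _ => ?_
    rw [space hu' i, space hv' j]
    ring
  rw [H.G_apply hy.1]
  simp only [e, time hu', time hv']
  ring

/-! ### Christoffel's symbols and the reciprocal of a warped metric -/

/-- The coordinate derivative `∂_c φ`, taken within `s`. -/
def coordDeriv (s : Set E₄) (c : Unit ⊕ Fin 3) (φ : E₄ → ℝ) (y : E₄) : ℝ :=
  fderivWithin ℝ φ s y (spacetimeBasis c)

/-- `κ_{ij} = a' h_{ij} + ½ a ∂ₜh_{ij}`, so that `½ ∂ₜ(a² h_{ij}) = a κ_{ij}`. -/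
def expansionForm (s : Set E₄) (I : Set ℝ) (a : ℝ → ℝ)
    (B : E₄ → E₄ →L[ℝ] E₄ →L[ℝ] ℝ) (i j : Fin 3) (y : E₄) : ℝ :=
  derivWithin a I y.1 * spatialGram B y i j + a y.1 * (1 / 2) *
    fderivWithin ℝ B s y (1, 0) (spacetimeBasis (Sum.inr i)) (spacetimeBasis (Sum.inr j))

/-- Christoffel's symbols of the first kind of the metric `h_{ij}` at constant time. -/
def spatialChristoffel (s : Set E₄)
    (B : E₄ → E₄ →L[ℝ] E₄ →L[ℝ] ℝ) (i j k : Fin 3) (y : E₄) : ℝ :=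
  1 / 2 * (fderivWithin ℝ B s y (spacetimeBasis (Sum.inr i)) (spacetimeBasis (Sum.inr j))
      (spacetimeBasis (Sum.inr k))
    + fderivWithin ℝ B s y (spacetimeBasis (Sum.inr j)) (spacetimeBasis (Sum.inr k))
      (spacetimeBasis (Sum.inr i))
    - fderivWithin ℝ B s y (spacetimeBasis (Sum.inr k)) (spacetimeBasis (Sum.inr i))
      (spacetimeBasis (Sum.inr j)))

/-- The contraction `h^{ij} M_{ij}` with the reciprocal spatial metric. -/
def spatialTrace (B : E₄ → E₄ →L[ℝ] E₄ →L[ℝ] ℝ) (y : E₄)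
    (M : Fin 3 → Fin 3 → ℝ) : ℝ :=
  ∑ i, ∑ j, (spatialGram B y)⁻¹ i j * M i j

theorem spatialTrace_mul (c : ℝ) (M : Fin 3 → Fin 3 → ℝ) :
    spatialTrace B y (fun i j => c * M i j) = c * spatialTrace B y M := by
  simp only [spatialTrace, Finset.mul_sum]
  exact Finset.sum_congr rfl fun i _ => Finset.sum_congr rfl fun j _ => by ring

theorem spatialTrace_sub (M M' : Fin 3 → Fin 3 → ℝ) :
    spatialTrace B y (fun i j => M i j - M' i j) = spatialTrace B y M - spatialTrace B y M' := by
  simp only [spatialTrace, mul_sub, Finset.sum_sub_distrib]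

namespace IsWarpedOn

theorem spatialTrace_swap (H : IsWarpedOn s I N a f G B) (hy : y ∈ s) (M : Fin 3 → Fin 3 → ℝ) :
    spatialTrace B y (fun i j => M j i) = spatialTrace B y M := by
  rw [spatialTrace, Finset.sum_comm]
  exact Finset.sum_congr rfl fun i _ => Finset.sum_congr rfl fun j _ => by
    rw [H.spatialGram_inv_symm hy]

theorem contDiffOn_spatialTrace (H : IsWarpedOn s I N a f G B)
    {M : Fin 3 → Fin 3 → E₄ → ℝ} (hM : ∀ i j, ContDiffOn ℝ ∞ (M i j) s) :
    ContDiffOn ℝ ∞ (fun y => spatialTrace B y fun i j => M i j y) s :=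
  ContDiffOn.sum fun i _ => ContDiffOn.sum fun j _ =>
    (H.contDiffOn_spatialGram_inv i j).mul (hM i j)

theorem contDiffOn_coordDeriv (H : IsWarpedOn s I N a f G B) (c : Unit ⊕ Fin 3)
    {φ : E₄ → ℝ} (hφ : ContDiffOn ℝ ∞ φ s) :
    ContDiffOn ℝ ∞ (coordDeriv s c φ) s :=
  ContDiffOn.fderivWithin_apply_field H.uniqueDiffOn hφ contDiffOn_const

theorem contDiffOn_expansionForm (H : IsWarpedOn s I N a f G B) (i j : Fin 3) :
    ContDiffOn ℝ ∞ (expansionForm s I a B i j) s := by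
  have hDB := ContDiffOn.fderivWithin_apply_field (X := fun _ => (1, 0)) H.uniqueDiffOn
    H.contDiffOn_B contDiffOn_const
  exact ((H.contDiffOn_comp_fst (H.contDiffOn_derivWithin H.contDiffOn_a)).mul
      (H.contDiffOn_spatialGram i j)).add
    (((H.contDiffOn_comp_fst H.contDiffOn_a).mul contDiffOn_const).mul
      ((hDB.clm_apply contDiffOn_const).clm_apply contDiffOn_const))

theorem contDiffOn_spatialChristoffel (H : IsWarpedOn s I N a f G B) (i j k : Fin 3) :
    ContDiffOn ℝ ∞ (spatialChristoffel s B i j k) s := by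
  have hDB := fun u v w : E₄ =>
    ((ContDiffOn.fderivWithin_apply_field (X := fun _ => u) H.uniqueDiffOn H.contDiffOn_B
      contDiffOn_const).clm_apply (contDiffOn_const (c := v))).clm_apply (contDiffOn_const (c := w))
  exact contDiffOn_const.mul (((hDB _ _ _).add (hDB _ _ _)).sub (hDB _ _ _))

theorem coordDeriv_time_mul (H : IsWarpedOn s I N a f G B) (hy : y ∈ s)
    {φ : E₄ → ℝ} (hφ : ContDiffOn ℝ ∞ φ s) :
    coordDeriv s (Sum.inl ()) (fun y => a y.1 * φ y) y
      = derivWithin a I y.1 * φ y + a y.1 * coordDeriv s (Sum.inl ()) φ y := by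
  rw [coordDeriv, ((H.hasFDerivWithinAt_comp_fst H.contDiffOn_a hy).fun_mul
    (hφ.differentiableOn (by simp) y hy).hasFDerivWithinAt).fderivWithin (H.uniqueDiffOn y hy)]
  simp [spacetimeBasis_inl, coordDeriv]
  ring

theorem coordDeriv_space_mul (H : IsWarpedOn s I N a f G B) (hy : y ∈ s)
    {φ : E₄ → ℝ} (hφ : ContDiffOn ℝ ∞ φ s) (i : Fin 3) :
    coordDeriv s (Sum.inr i) (fun y => a y.1 * φ y) y
      = a y.1 * coordDeriv s (Sum.inr i) φ y := by
  rw [coordDeriv, ((H.hasFDerivWithinAt_comp_fst H.contDiffOn_a hy).fun_mul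
    (hφ.differentiableOn (by simp) y hy).hasFDerivWithinAt).fderivWithin (H.uniqueDiffOn y hy)]
  simp [spacetimeBasis_inr, coordDeriv]

theorem christoffel_eq (H : IsWarpedOn s I N a f G B) (hy : y ∈ s) (i j k : Unit ⊕ Fin 3) :
    christoffel spacetimeBasis G s i j k y =
      match i, j, k with
      | .inl _, .inl _, .inl _ => -(N y.1 * derivWithin N I y.1)
      | .inl _, .inr i, .inr j => a y.1 * expansionForm s I a B i j y
      | .inr i, .inl _, .inr j => a y.1 * expansionForm s I a B i j y
      | .inr i, .inr j, .inl _ => -(a y.1 * expansionForm s I a B i j y)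
      | .inr i, .inr j, .inr k => a y.1 * (a y.1 * spatialChristoffel s B i j k y)
      | _, _, _ => 0 := by
  have h1 := H.B_time y hy
  have h2 : ∀ v, B y v (1, 0) = 0 := fun v => (H.B_symm y hy _ _).trans (h1 v)
  have h3 := H.fderivWithin_B_time hy
  have h4 : ∀ u v, fderivWithin ℝ B s y u v (1, 0) = 0 :=
    fun u v => (H.fderivWithin_B_symm hy _ _ _).trans (h3 u v)
  have h5 : ∀ i, (spacetimeBasis (Sum.inr i)).1 = 0 := fun i => by rw [spacetimeBasis_inr]
  rw [christoffel, H.koszul_eq hy contDiffOn_const contDiffOn_const]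
  rcases i with i | i <;> rcases j with j | j <;> rcases k with k | k <;>
    simp only [spacetimeBasis_inl, h1, h2, h3, h4, h5, fderivWithin_fun_const, Pi.zero_apply,
      _root_.zero_apply, Prod.fst_zero, map_zero] <;>
    try simp only [expansionForm, spatialChristoffel, spatialGram, Matrix.of_apply]
  all_goals first
    | ring1
    | (rw [H.fderivWithin_B_symm hy _ (spacetimeBasis (Sum.inr k)) (spacetimeBasis (Sum.inr i))]
       ring1)

theorem metricComp_eq (H : IsWarpedOn s I N a f G B) (hy : y ∈ s) (i j : Unit ⊕ Fin 3) :
    metricComp spacetimeBasis G y i j =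
      match i, j with
      | .inl _, .inl _ => -(N y.1 ^ 2)
      | .inr i, .inr j => a y.1 ^ 2 * spatialGram B y i j
      | _, _ => 0 := by
  rw [metricComp, Matrix.of_apply, H.G_apply hy]
  rcases i with i | i <;> rcases j with j | j
  · simp [spacetimeBasis_inl, H.B_time y hy]
  · simp [spacetimeBasis_inl, spacetimeBasis_inr, H.B_time y hy]
  · rw [H.B_symm y hy]
    simp [spacetimeBasis_inl, spacetimeBasis_inr, H.B_time y hy]
  · simp [spatialGram, spacetimeBasis_inr]

theorem invMetricComp_eq (H : IsWarpedOn s I N a f G B) (hy : y ∈ s) (ha : a y.1 ≠ 0) :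
    invMetricComp spacetimeBasis G y = Matrix.fromBlocks (Matrix.of fun _ _ => -(1 / N y.1 ^ 2)) 0 0
      ((1 / a y.1 ^ 2) • (spatialGram B y)⁻¹) := by
  have hN := H.N_ne_zero hy ha
  have hm : metricComp spacetimeBasis G y = Matrix.fromBlocks
      (Matrix.of fun _ _ => -(N y.1 ^ 2)) 0 0 ((a y.1 ^ 2) • spatialGram B y) := by
    ext i j
    rw [H.metricComp_eq hy]
    rcases i with i | i <;> rcases j with j | j <;> simp
  rw [invMetricComp, hm]
  refine Matrix.inv_eq_right_inv ?_
  rw [Matrix.fromBlocks_multiply, ← Matrix.fromBlocks_one]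
  congr 1
  · ext i j
    simp [Matrix.mul_apply, hN]
  · simp
  · simp
  · simp [Matrix.mul_nonsing_inv _ (H.isUnit_det_spatialGram hy), smul_smul, ha]

/-- Contraction with the reciprocal metric, split into its time and space parts. -/
theorem sum_invMetricComp (H : IsWarpedOn s I N a f G B) (hy : y ∈ s) (ha : a y.1 ≠ 0)
    (M : Unit ⊕ Fin 3 → Unit ⊕ Fin 3 → ℝ) :
    ∑ p, ∑ q, invMetricComp spacetimeBasis G y p q * M p q
      = -(1 / N y.1 ^ 2) * M (Sum.inl ()) (Sum.inl ())
        + 1 / a y.1 ^ 2 * spatialTrace B y (fun i j => M (Sum.inr i) (Sum.inr j)) := by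
  simp only [H.invMetricComp_eq hy ha, Fintype.sum_sum_type, Finset.univ_unique,
    PUnit.default_eq_unit, Finset.sum_singleton, Matrix.fromBlocks_apply₁₁, Matrix.fromBlocks_apply₁₂,
    Matrix.fromBlocks_apply₂₁, Matrix.fromBlocks_apply₂₂, Matrix.of_apply, Matrix.zero_apply,
    zero_mul, Finset.sum_const_zero, add_zero, zero_add, Matrix.smul_apply, smul_eq_mul,
    spatialTrace, Finset.mul_sum, mul_assoc]

theorem riemann_eq (H : IsWarpedOn s I N a f G B) (hy : y ∈ s) (ha : a y.1 ≠ 0)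
    (i j k l : Unit ⊕ Fin 3) :
    riemann spacetimeBasis G s i j k l y =
      coordDeriv s i (christoffel spacetimeBasis G s j k l) y
      - coordDeriv s j (christoffel spacetimeBasis G s i k l) y
      - 1 / N y.1 ^ 2 * (christoffel spacetimeBasis G s i k (Sum.inl ()) y
          * christoffel spacetimeBasis G s j l (Sum.inl ()) y
        - christoffel spacetimeBasis G s j k (Sum.inl ()) y
          * christoffel spacetimeBasis G s i l (Sum.inl ()) y)
      + 1 / a y.1 ^ 2 * spatialTrace B y (fun p q =>
        christoffel spacetimeBasis G s i k (Sum.inr p) y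
          * christoffel spacetimeBasis G s j l (Sum.inr q) y
        - christoffel spacetimeBasis G s j k (Sum.inr p) y
          * christoffel spacetimeBasis G s i l (Sum.inr q) y) := by
  rw [riemann, H.sum_invMetricComp hy ha, coordDeriv, coordDeriv]
  ring

end IsWarpedOn

/-! ### The Riemann curvature of a warped metric -/

/-- The components `R_{0i0j}`, in a form that makes sense for `a = 0` and `N = 0`. -/
def curvTimeTime (s : Set E₄) (I : Set ℝ) (N a f : ℝ → ℝ)
    (B : E₄ → E₄ →L[ℝ] E₄ →L[ℝ] ℝ) (i j : Fin 3) (y : E₄) : ℝ :=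
  derivWithin a I y.1 * expansionForm s I a B i j y
    + a y.1 * coordDeriv s (Sum.inl ()) (expansionForm s I a B i j) y
    - derivWithin N I y.1 * f y.1 * expansionForm s I a B i j y
    - spatialTrace B y fun p q => expansionForm s I a B i p y * expansionForm s I a B j q y

/-- The components `R_{0ijk}`, divided by `a`. -/
def curvTimeSpace (s : Set E₄) (I : Set ℝ) (a : ℝ → ℝ)
    (B : E₄ → E₄ →L[ℝ] E₄ →L[ℝ] ℝ) (i j k : Fin 3) (y : E₄) : ℝ :=
  2 * derivWithin a I y.1 * spatialChristoffel s B i j k y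
    + a y.1 * coordDeriv s (Sum.inl ()) (spatialChristoffel s B i j k) y
    - coordDeriv s (Sum.inr i) (expansionForm s I a B j k) y
    + spatialTrace B y fun p q => expansionForm s I a B j p y * spatialChristoffel s B i k q y
        - spatialChristoffel s B i j p y * expansionForm s I a B k q y

/-- The components `R_{ij0k}`, divided by `a`. -/
def curvSpaceTime (s : Set E₄) (I : Set ℝ) (a : ℝ → ℝ)
    (B : E₄ → E₄ →L[ℝ] E₄ →L[ℝ] ℝ) (i j k : Fin 3) (y : E₄) : ℝ :=
  coordDeriv s (Sum.inr i) (expansionForm s I a B j k) y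
    - coordDeriv s (Sum.inr j) (expansionForm s I a B i k) y
    + spatialTrace B y fun p q => expansionForm s I a B i p y * spatialChristoffel s B j k q y
        - expansionForm s I a B j p y * spatialChristoffel s B i k q y

/-- The components `R_{ijkl}`, divided by `f²`: the curvature of `h` contributes
`a² r_{ijkl} = f² N² r_{ijkl}`, and the Gauss equation the quadratic terms in `κ`. -/
def curvSpaceSpace (s : Set E₄) (I : Set ℝ) (N a : ℝ → ℝ)
    (B : E₄ → E₄ →L[ℝ] E₄ →L[ℝ] ℝ) (i j k l : Fin 3) (y : E₄) : ℝ :=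
  N y.1 ^ 2 * (coordDeriv s (Sum.inr i) (spatialChristoffel s B j k l) y
      - coordDeriv s (Sum.inr j) (spatialChristoffel s B i k l) y
      + spatialTrace B y fun p q => spatialChristoffel s B i k p y * spatialChristoffel s B j l q y
        - spatialChristoffel s B j k p y * spatialChristoffel s B i l q y)
    - (expansionForm s I a B i k y * expansionForm s I a B j l y
      - expansionForm s I a B j k y * expansionForm s I a B i l y)

theorem coordDeriv_congr {φ ψ : E₄ → ℝ} (hy : y ∈ s)
    (h : ∀ z ∈ s, φ z = ψ z) (c : Unit ⊕ Fin 3) : coordDeriv s c φ y = coordDeriv s c ψ y := by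
  rw [coordDeriv, fderivWithin_congr h (h y hy), coordDeriv]

theorem coordDeriv_const (r : ℝ) (c : Unit ⊕ Fin 3) : coordDeriv s c (fun _ => r) y = 0 := by
  simp [coordDeriv]

theorem coordDeriv_neg (φ : E₄ → ℝ) (hs : UniqueDiffWithinAt ℝ s y)
    (c : Unit ⊕ Fin 3) : coordDeriv s c (fun y => -φ y) y = -coordDeriv s c φ y := by
  rw [coordDeriv, fderivWithin_fun_neg hs, coordDeriv]
  simp

namespace IsWarpedOn

theorem contDiffOn_curvTimeTime (H : IsWarpedOn s I N a f G B) (i j : Fin 3) :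
    ContDiffOn ℝ ∞ (curvTimeTime s I N a f B i j) s := by
  have hκ := H.contDiffOn_expansionForm
  have ha := H.contDiffOn_comp_fst H.contDiffOn_a
  have ha' := H.contDiffOn_comp_fst (H.contDiffOn_derivWithin H.contDiffOn_a)
  have hN' := H.contDiffOn_comp_fst (H.contDiffOn_derivWithin H.contDiffOn_N)
  exact (((ha'.mul (hκ i j)).add (ha.mul (H.contDiffOn_coordDeriv _ (hκ i j)))).sub
    ((hN'.mul (H.contDiffOn_comp_fst H.contDiffOn_f)).mul (hκ i j))).sub
    (H.contDiffOn_spatialTrace fun p q => (hκ i p).mul (hκ j q))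

theorem contDiffOn_curvTimeSpace (H : IsWarpedOn s I N a f G B) (i j k : Fin 3) :
    ContDiffOn ℝ ∞ (curvTimeSpace s I a B i j k) s := by
  have hκ := H.contDiffOn_expansionForm
  have hγ := H.contDiffOn_spatialChristoffel
  have ha := H.contDiffOn_comp_fst H.contDiffOn_a
  have ha' := H.contDiffOn_comp_fst (H.contDiffOn_derivWithin H.contDiffOn_a)
  exact ((((contDiffOn_const.mul ha').mul (hγ i j k)).add
    (ha.mul (H.contDiffOn_coordDeriv _ (hγ i j k)))).sub (H.contDiffOn_coordDeriv _ (hκ j k))).add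
    (H.contDiffOn_spatialTrace fun p q => ((hκ j p).mul (hγ i k q)).sub ((hγ i j p).mul (hκ k q)))

theorem contDiffOn_curvSpaceTime (H : IsWarpedOn s I N a f G B) (i j k : Fin 3) :
    ContDiffOn ℝ ∞ (curvSpaceTime s I a B i j k) s := by
  have hκ := H.contDiffOn_expansionForm
  have hγ := H.contDiffOn_spatialChristoffel
  exact ((H.contDiffOn_coordDeriv _ (hκ j k)).sub (H.contDiffOn_coordDeriv _ (hκ i k))).add
    (H.contDiffOn_spatialTrace fun p q => ((hκ i p).mul (hγ j k q)).sub ((hκ j p).mul (hγ i k q)))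

theorem contDiffOn_curvSpaceSpace (H : IsWarpedOn s I N a f G B) (i j k l : Fin 3) :
    ContDiffOn ℝ ∞ (curvSpaceSpace s I N a B i j k l) s := by
  have hκ := H.contDiffOn_expansionForm
  have hγ := H.contDiffOn_spatialChristoffel
  exact (((H.contDiffOn_comp_fst H.contDiffOn_N).pow 2).mul
    (((H.contDiffOn_coordDeriv _ (hγ j k l)).sub (H.contDiffOn_coordDeriv _ (hγ i k l))).add
      (H.contDiffOn_spatialTrace fun p q =>
        ((hγ i k p).mul (hγ j l q)).sub ((hγ j k p).mul (hγ i l q))))).sub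
    (((hκ i k).mul (hκ j l)).sub ((hκ j k).mul (hκ i l)))

/-- The factor `a⁻²` of the reciprocal metric is absorbed by the factors `a` of the two Christoffel
symbols that are contracted. -/
theorem spatialTrace_a_sq (ha : a y.1 ≠ 0) (M M' : Fin 3 → Fin 3 → ℝ) (c : ℝ)
    (h : ∀ p q, M p q = a y.1 ^ 2 * c * M' p q) :
    1 / a y.1 ^ 2 * spatialTrace B y M = c * spatialTrace B y M' := by
  have : M = fun p q => a y.1 ^ 2 * c * M' p q := funext fun p => funext fun q => h p q
  rw [this, spatialTrace_mul]
  field_simp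

/-- The weights of the Riemann tensor: no negative power of `a` or `N` remains. The only factor `N⁻¹`
with `R_{0i0j}` comes from `Γ_{000} = -N N'` and multiplies `a = f N`. -/
theorem riemann_eq_blockTensor (H : IsWarpedOn s I N a f G B) (hy : y ∈ s) (ha : a y.1 ≠ 0)
    (i j k l : Unit ⊕ Fin 3) :
    riemann spacetimeBasis G s i j k l y =
      blockTensor (a y.1) (f y.1 ^ 2) (fun i j => curvTimeTime s I N a f B i j y)
        (fun i j k => curvTimeSpace s I a B i j k y) (fun i j k => curvSpaceTime s I a B i j k y)
        (fun i j k l => curvSpaceSpace s I N a B i j k l y) i j k l := by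
  have hs := H.uniqueDiffOn y hy
  have hκ := H.contDiffOn_expansionForm
  have hγ := H.contDiffOn_spatialChristoffel
  have haγ : ∀ i j k, ContDiffOn ℝ ∞ (fun y => a y.1 * spatialChristoffel s B i j k y) s :=
    fun i j k => (H.contDiffOn_comp_fst H.contDiffOn_a).mul (hγ i j k)
  have hN := H.N_ne_zero hy ha
  have hfa := H.a_eq y.1 (H.fst_mem y hy)
  -- `Γ_{000}` depends on the time only
  have hNN : ∀ i : Fin 3, coordDeriv s (Sum.inr i)
      (fun y => -(N y.1 * derivWithin N I y.1)) y = 0 := by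
    intro i
    rw [coordDeriv, H.fderivWithin_comp_fst (φ := fun t => -(N t * derivWithin N I t))
      (H.contDiffOn_N.mul (H.contDiffOn_derivWithin H.contDiffOn_N)).neg hy, spacetimeBasis_inr]
    simp
  have hD : ∀ c i j k, coordDeriv s c (christoffel spacetimeBasis G s i j k) y = coordDeriv s c
      (fun y => match i, j, k with
      | .inl _, .inl _, .inl _ => -(N y.1 * derivWithin N I y.1)
      | .inl _, .inr i, .inr j => a y.1 * expansionForm s I a B i j y
      | .inr i, .inl _, .inr j => a y.1 * expansionForm s I a B i j y
      | .inr i, .inr j, .inl _ => -(a y.1 * expansionForm s I a B i j y)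
      | .inr i, .inr j, .inr k => a y.1 * (a y.1 * spatialChristoffel s B i j k y)
      | _, _, _ => 0) y :=
    fun c i j k => coordDeriv_congr hy (fun z hz => H.christoffel_eq hz i j k) c
  have hDκ := fun i j => H.coordDeriv_time_mul hy (hκ i j)
  have hDκ' := fun i j => H.coordDeriv_space_mul hy (hκ i j)
  have hDγ := fun i j k => H.coordDeriv_time_mul hy (hγ i j k)
  have hDγ' := fun i j k => H.coordDeriv_space_mul hy (hγ i j k)
  have hDaγ := fun i j k => H.coordDeriv_time_mul hy (haγ i j k)
  have hDaγ' := fun i j k => H.coordDeriv_space_mul hy (haγ i j k)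
  have h00 : ∀ k l, riemann spacetimeBasis G s (Sum.inl ()) (Sum.inl ()) k l y = 0 := by
    intro k l
    linear_combination (1 / 2) * riemann_antisymm spacetimeBasis G s (Sum.inl ()) (Sum.inl ()) k l y
  have h0i : ∀ i k l, riemann spacetimeBasis G s (Sum.inl ()) (Sum.inr i) k l y =
      blockTensor (a y.1) (f y.1 ^ 2) (fun i j => curvTimeTime s I N a f B i j y)
        (fun i j k => curvTimeSpace s I a B i j k y) (fun i j k => curvSpaceTime s I a B i j k y)
        (fun i j k l => curvSpaceSpace s I N a B i j k l y) (Sum.inl ()) (Sum.inr i) k l := by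
    intro i k l
    rw [H.riemann_eq hy ha, hD, hD]
    simp only [H.christoffel_eq hy]
    rcases k with k | k <;> rcases l with l | l <;> simp only [blockTensor]
    · rw [hNN, coordDeriv_const, spatialTrace_a_sq ha _ (fun _ _ => 0) 0 fun p q => by ring]
      ring
    · rw [coordDeriv_const, hDκ, spatialTrace_a_sq ha _ (fun p q => expansionForm s I a B i p y
        * expansionForm s I a B l q y) (-1) fun p q => by ring, curvTimeTime, hfa]
      field_simp
      ring
    · rw [coordDeriv_const, coordDeriv_neg _ hs, hDκ,
        ← H.spatialTrace_swap hy, spatialTrace_a_sq ha _ (fun p q => expansionForm s I a B i p y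
        * expansionForm s I a B k q y) 1 fun p q => by ring, curvTimeTime, hfa]
      field_simp
      ring
    · rw [hDaγ, hDγ, hDκ', spatialTrace_a_sq ha _ (fun p q => expansionForm s I a B k p y
          * spatialChristoffel s B i l q y - spatialChristoffel s B i k p y
          * expansionForm s I a B l q y) (a y.1) fun p q => by ring, curvTimeSpace]
      ring
  rcases i with i | i <;> rcases j with j | j
  · rw [h00]
    rcases k with k | k <;> rcases l with l | l <;> rfl
  · exact h0i j k l
  · rw [riemann_antisymm, h0i]
    rcases k with k | k <;> rcases l with l | l <;> simp [blockTensor]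
  · rw [H.riemann_eq hy ha, hD, hD]
    simp only [H.christoffel_eq hy]
    rcases k with k | k <;> rcases l with l | l <;> simp only [blockTensor]
    · have h0 : spatialTrace B y (fun p q => a y.1 * expansionForm s I a B i p y
          * (a y.1 * expansionForm s I a B j q y) - a y.1 * expansionForm s I a B j p y
          * (a y.1 * expansionForm s I a B i q y)) = 0 := by
        rw [spatialTrace_sub, ← H.spatialTrace_swap hy, sub_eq_zero]
        exact congrArg _ (funext fun p => funext fun q => mul_comm _ _)
      rw [coordDeriv_const, coordDeriv_const, h0]
      ring
    · rw [hDκ', hDκ', spatialTrace_a_sq ha _ (fun p q => expansionForm s I a B i p y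
          * spatialChristoffel s B j l q y - expansionForm s I a B j p y
          * spatialChristoffel s B i l q y) (a y.1) fun p q => by ring, curvSpaceTime]
      ring
    · rw [coordDeriv_neg _ hs, coordDeriv_neg _ hs, hDκ', hDκ', ← H.spatialTrace_swap hy,
        spatialTrace_a_sq ha _ (fun p q => expansionForm s I a B i p y
          * spatialChristoffel s B j k q y - expansionForm s I a B j p y
          * spatialChristoffel s B i k q y) (-a y.1) fun p q => by ring, curvSpaceTime]
      ring
    · rw [hDaγ', hDγ', hDaγ', hDγ',
        spatialTrace_a_sq ha _ (fun p q => spatialChristoffel s B i k p y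
          * spatialChristoffel s B j l q y - spatialChristoffel s B j k p y
          * spatialChristoffel s B i l q y) (a y.1 ^ 2) fun p q => by ring, curvSpaceSpace, hfa]
      field_simp
      ring

end IsWarpedOn

/-! ### Ricci, scalar and Weyl curvature of a warped metric -/

/-- The spatial components `R_{ij}` of the Ricci curvature, multiplied by `N²`. -/
def spaceRicci (s : Set E₄) (I : Set ℝ) (N a f : ℝ → ℝ)
    (B : E₄ → E₄ →L[ℝ] E₄ →L[ℝ] ℝ) (i j : Fin 3) (y : E₄) : ℝ :=
  -curvTimeTime s I N a f B i j y + spatialTrace B y fun p q => curvSpaceSpace s I N a B i p j q y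

/-- The scalar curvature, multiplied by `N² a²`. -/
def scaledScalar (s : Set E₄) (I : Set ℝ) (N a f : ℝ → ℝ)
    (B : E₄ → E₄ →L[ℝ] E₄ →L[ℝ] ℝ) (y : E₄) : ℝ :=
  (spatialTrace B y fun p q => spaceRicci s I N a f B p q y)
    - spatialTrace B y fun p q => curvTimeTime s I N a f B p q y

/-- The smooth extension of the Riemann tensor across `a = 0`. -/
def riemannExt (s : Set E₄) (I : Set ℝ) (N a f : ℝ → ℝ)
    (B : E₄ → E₄ →L[ℝ] E₄ →L[ℝ] ℝ) (i j k l : Unit ⊕ Fin 3) (y : E₄) : ℝ :=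
  blockTensor (a y.1) (f y.1 ^ 2) (fun i j => curvTimeTime s I N a f B i j y)
    (fun i j k => curvTimeSpace s I a B i j k y) (fun i j k => curvSpaceTime s I a B i j k y)
    (fun i j k l => curvSpaceSpace s I N a B i j k l y) i j k l

/-- The smooth extension of `Ric ∘ g` across `a = 0`. With `Ric` of weights `R_{00} ∼ a⁻²`,
`R_{0i} ∼ a⁻¹`, `R_{ij} ∼ N⁻²` and `g` of weights `N²`, `a²`, it has weights `1`, `a`, `a² N⁻² = f²`. -/
def ricciKNExt (s : Set E₄) (I : Set ℝ) (N a f : ℝ → ℝ)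
    (B : E₄ → E₄ →L[ℝ] E₄ →L[ℝ] ℝ) (i j k l : Unit ⊕ Fin 3) (y : E₄) : ℝ :=
  blockTensor (a y.1) (f y.1 ^ 2)
    (fun i j => (spatialTrace B y fun p q => curvTimeTime s I N a f B p q y) * spatialGram B y i j
      - spaceRicci s I N a f B i j y)
    (fun i j k =>
      (spatialTrace B y fun p q => curvTimeSpace s I a B p j q y) * spatialGram B y i k
        - (spatialTrace B y fun p q => curvTimeSpace s I a B p k q y) * spatialGram B y i j)
    (fun i j k =>
      (spatialTrace B y fun p q => curvSpaceTime s I a B i p q y) * spatialGram B y j k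
        - (spatialTrace B y fun p q => curvSpaceTime s I a B j p q y) * spatialGram B y i k)
    (fun i j k l =>
      spaceRicci s I N a f B i k y * spatialGram B y j l
        - spaceRicci s I N a f B i l y * spatialGram B y j k
        + spaceRicci s I N a f B j l y * spatialGram B y i k
        - spaceRicci s I N a f B j k y * spatialGram B y i l) i j k l

/-- The smooth extension of `R g ∘ g` across `a = 0`. As `R ∼ N⁻² a⁻²`, the weights `N² a²` and `a⁴`
of `g ∘ g` become `1` and `f²`. -/
def scalarKNExt (s : Set E₄) (I : Set ℝ) (N a f : ℝ → ℝ)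
    (B : E₄ → E₄ →L[ℝ] E₄ →L[ℝ] ℝ) (i j k l : Unit ⊕ Fin 3) (y : E₄) : ℝ :=
  blockTensor (a y.1) (f y.1 ^ 2)
    (fun i j => -2 * (scaledScalar s I N a f B y * spatialGram B y i j))
    (fun _ _ _ => 0) (fun _ _ _ => 0)
    (fun i j k l =>
      2 * scaledScalar s I N a f B y * (spatialGram B y i k * spatialGram B y j l
        - spatialGram B y i l * spatialGram B y j k)) i j k l

namespace IsWarpedOn

theorem contDiffOn_spaceRicci (H : IsWarpedOn s I N a f G B) (i j : Fin 3) :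
    ContDiffOn ℝ ∞ (spaceRicci s I N a f B i j) s :=
  (H.contDiffOn_curvTimeTime i j).neg.add
    (H.contDiffOn_spatialTrace fun p q => H.contDiffOn_curvSpaceSpace i p j q)

theorem contDiffOn_scaledScalar (H : IsWarpedOn s I N a f G B) :
    ContDiffOn ℝ ∞ (scaledScalar s I N a f B) s :=
  (H.contDiffOn_spatialTrace H.contDiffOn_spaceRicci).sub
    (H.contDiffOn_spatialTrace H.contDiffOn_curvTimeTime)

theorem contDiffOn_riemannExt (H : IsWarpedOn s I N a f G B) (i j k l : Unit ⊕ Fin 3) :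
    ContDiffOn ℝ ∞ (riemannExt s I N a f B i j k l) s :=
  contDiffOn_blockTensor (H.contDiffOn_comp_fst H.contDiffOn_a)
    ((H.contDiffOn_comp_fst H.contDiffOn_f).pow 2) H.contDiffOn_curvTimeTime
    H.contDiffOn_curvTimeSpace H.contDiffOn_curvSpaceTime H.contDiffOn_curvSpaceSpace i j k l

theorem contDiffOn_ricciKNExt (H : IsWarpedOn s I N a f G B) (i j k l : Unit ⊕ Fin 3) :
    ContDiffOn ℝ ∞ (ricciKNExt s I N a f B i j k l) s := by
  have hh := H.contDiffOn_spatialGram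
  have hV := H.contDiffOn_spaceRicci
  have hρ := fun j => H.contDiffOn_spatialTrace fun p q => H.contDiffOn_curvTimeSpace p j q
  have hρ' := fun i => H.contDiffOn_spatialTrace fun p q => H.contDiffOn_curvSpaceTime i p q
  exact contDiffOn_blockTensor (H.contDiffOn_comp_fst H.contDiffOn_a)
    ((H.contDiffOn_comp_fst H.contDiffOn_f).pow 2)
    (fun i j => ((H.contDiffOn_spatialTrace H.contDiffOn_curvTimeTime).mul (hh i j)).sub (hV i j))
    (fun i j k => ((hρ j).mul (hh i k)).sub ((hρ k).mul (hh i j)))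
    (fun i j k => ((hρ' i).mul (hh j k)).sub ((hρ' j).mul (hh i k)))
    (fun i j k l => ((((hV i k).mul (hh j l)).sub ((hV i l).mul (hh j k))).add
      ((hV j l).mul (hh i k))).sub ((hV j k).mul (hh i l))) i j k l

theorem contDiffOn_scalarKNExt (H : IsWarpedOn s I N a f G B) (i j k l : Unit ⊕ Fin 3) :
    ContDiffOn ℝ ∞ (scalarKNExt s I N a f B i j k l) s := by
  have hh := H.contDiffOn_spatialGram
  have hW := H.contDiffOn_scaledScalar
  exact contDiffOn_blockTensor (H.contDiffOn_comp_fst H.contDiffOn_a)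
    ((H.contDiffOn_comp_fst H.contDiffOn_f).pow 2)
    (fun i j => contDiffOn_const.mul (hW.mul (hh i j)))
    (fun _ _ _ => contDiffOn_const) (fun _ _ _ => contDiffOn_const)
    (fun i j k l => (contDiffOn_const.mul hW).mul
      (((hh i k).mul (hh j l)).sub ((hh i l).mul (hh j k)))) i j k l

theorem ricci_eq (H : IsWarpedOn s I N a f G B) (hy : y ∈ s) (ha : a y.1 ≠ 0)
    (i j : Unit ⊕ Fin 3) :
    ricci spacetimeBasis G s i j y =
      match i, j with
      | .inl _, .inl _ => 1 / a y.1 ^ 2 *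
          spatialTrace B y fun p q => curvTimeTime s I N a f B p q y
      | .inl _, .inr j => 1 / a y.1 * spatialTrace B y fun p q => curvTimeSpace s I a B p j q y
      | .inr i, .inl _ => 1 / a y.1 * spatialTrace B y fun p q => curvSpaceTime s I a B i p q y
      | .inr i, .inr j => 1 / N y.1 ^ 2 * spaceRicci s I N a f B i j y := by
  have hN := H.N_ne_zero hy ha
  have hfa := H.a_eq y.1 (H.fst_mem y hy)
  rw [ricci, H.sum_invMetricComp hy ha]
  simp only [H.riemann_eq_blockTensor hy ha]
  rcases i with i | i <;> rcases j with j | j <;> simp only [blockTensor]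
  · ring
  · rw [spatialTrace_mul]
    field_simp
    ring
  · rw [spatialTrace_mul]
    field_simp
    ring
  -- `R_{ij}` has the terms `g^{00} R_{i0j0}` and `a⁻² f² h^{pq} w_{ipjq}`, and `f² = a² N⁻²`
  · rw [spatialTrace_mul, spaceRicci]
    rw [hfa] at ha ⊢
    have hf := left_ne_zero_of_mul ha
    field_simp

theorem scalarCurv_eq (H : IsWarpedOn s I N a f G B) (hy : y ∈ s) (ha : a y.1 ≠ 0) :
    scalarCurv spacetimeBasis G s y
      = 1 / (N y.1 ^ 2 * a y.1 ^ 2) * scaledScalar s I N a f B y := by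
  have hN := H.N_ne_zero hy ha
  rw [scalarCurv, H.sum_invMetricComp hy ha]
  simp only [H.ricci_eq hy ha]
  rw [spatialTrace_mul, scaledScalar]
  field_simp
  ring

theorem ricciKN_eq (H : IsWarpedOn s I N a f G B) (hy : y ∈ s) (ha : a y.1 ≠ 0)
    (i j k l : Unit ⊕ Fin 3) :
    ricciKN spacetimeBasis G s i j k l y = ricciKNExt s I N a f B i j k l y := by
  have hN := H.N_ne_zero hy ha
  have hf : f y.1 ^ 2 = a y.1 ^ 2 / N y.1 ^ 2 := by
    rw [H.a_eq y.1 (H.fst_mem y hy)]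
    field_simp
  simp only [ricciKN, kulkarniNomizu, ricciKNExt, hf, H.ricci_eq hy ha, H.metricComp_eq hy]
  rcases i with i | i <;> rcases j with j | j <;> rcases k with k | k <;> rcases l with l | l <;>
    simp only [blockTensor] <;> field_simp <;> ring

theorem scalarKN_eq (H : IsWarpedOn s I N a f G B) (hy : y ∈ s) (ha : a y.1 ≠ 0)
    (i j k l : Unit ⊕ Fin 3) :
    scalarKN spacetimeBasis G s i j k l y = scalarKNExt s I N a f B i j k l y := by
  have hN := H.N_ne_zero hy ha
  have hf : f y.1 ^ 2 = a y.1 ^ 2 / N y.1 ^ 2 := by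
    rw [H.a_eq y.1 (H.fst_mem y hy)]
    field_simp
  simp only [scalarKN, kulkarniNomizu, scalarKNExt, hf, H.scalarCurv_eq hy ha,
    H.metricComp_eq hy]
  rcases i with i | i <;> rcases j with j | j <;> rcases k with k | k <;> rcases l with l | l <;>
    simp only [blockTensor] <;> field_simp <;> ring

end IsWarpedOn

theorem scalarPart_eq_scalarKN (i j k l : Unit ⊕ Fin 3) :
    scalarPart spacetimeBasis G s i j k l y = 1 / 24 * scalarKN spacetimeBasis G s i j k l y := by
  simp only [scalarPart, scalarKN, Fintype.card_sum, Fintype.card_unit, Fintype.card_fin]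
  norm_num
  ring

theorem semiTracelessPart_eq (i j k l : Unit ⊕ Fin 3) :
    semiTracelessPart spacetimeBasis G s i j k l y
      = 1 / 2 * ricciKN spacetimeBasis G s i j k l y
        - 1 / 8 * scalarKN spacetimeBasis G s i j k l y := by
  simp only [semiTracelessPart, tracelessRicci, ricciKN, scalarKN, kulkarniNomizu,
    Fintype.card_sum, Fintype.card_unit, Fintype.card_fin]
  norm_num
  ring

/-- In dimension `4`, `C = Riem - R/24 g ∘ g - ½ (Ric - R/4 g) ∘ g`. -/
theorem weyl_eq (i j k l : Unit ⊕ Fin 3) :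
    weyl spacetimeBasis G s i j k l y
      = riemann spacetimeBasis G s i j k l y + -(1 / 2) * ricciKN spacetimeBasis G s i j k l y
        + 1 / 12 * scalarKN spacetimeBasis G s i j k l y := by
  rw [weyl, scalarPart_eq_scalarKN, semiTracelessPart_eq]
  ring

/-- Where `N` vanishes so does `a`, and the curvature becomes that of a homogeneous and isotropic
metric: with `c = a'`, `R_{0i0j} = -c² h_{ij}` and
`R_{ijkl} = -c² f² (h_{ik} h_{jl} - h_{jk} h_{il})`, which is pure trace. -/
theorem IsWarpedOn.weylExt_eq_zero (H : IsWarpedOn s I N a f G B) (hy : y ∈ s) (hN : N y.1 = 0)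
    (i j k l : Unit ⊕ Fin 3) :
    riemannExt s I N a f B i j k l y + -(1 / 2) * ricciKNExt s I N a f B i j k l y
      + 1 / 12 * scalarKNExt s I N a f B i j k l y = 0 := by
  have ha : a y.1 = 0 := by rw [H.a_eq y.1 (H.fst_mem y hy), hN, mul_zero]
  have ha' : derivWithin a I y.1 = f y.1 * derivWithin N I y.1 := by
    rw [H.derivWithin_a (H.fst_mem y hy), hN, mul_zero, zero_add]
  have hinv : ∀ i j, ∑ p, (spatialGram B y)⁻¹ i p * spatialGram B y p j
      = (1 : Matrix (Fin 3) (Fin 3) ℝ) i j := by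
    intro i j
    rw [← Matrix.nonsing_inv_mul _ (H.isUnit_det_spatialGram hy), Matrix.mul_apply]
  have hsymm : ∀ i j, spatialGram B y i j = spatialGram B y j i := fun i j => H.B_symm y hy _ _
  -- `h^{pq} h_{pq}` is the dimension of space
  have tr1 : ∀ r, spatialTrace B y (fun p q => r * spatialGram B y p q) = r * 3 := by
    intro r
    have : ∀ i, ∑ j, (spatialGram B y)⁻¹ i j * spatialGram B y i j = 1 := fun i => by
      simpa [hsymm] using hinv i i
    rw [spatialTrace_mul r (fun p q => spatialGram B y p q)]
    simp [spatialTrace, this]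
  have tr2 : ∀ i j, spatialTrace B y (fun p q => spatialGram B y i p * spatialGram B y j q)
      = spatialGram B y i j := by
    intro i j
    exact H.sum_spatialGram_inv hy (spacetimeBasis (Sum.inr i)) (spacetimeBasis (Sum.inr j))
  set c := derivWithin a I y.1 with hc
  have hκ : ∀ i j, expansionForm s I a B i j y = c * spatialGram B y i j := by
    intro i j
    rw [expansionForm, ha, ← hc]
    ring
  have hA : ∀ i j, curvTimeTime s I N a f B i j y = -c ^ 2 * spatialGram B y i j := by
    intro i j
    have h1 : spatialTrace B y
        (fun p q => expansionForm s I a B i p y * expansionForm s I a B j q y)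
          = c ^ 2 * spatialGram B y i j := by
      rw [← tr2, ← spatialTrace_mul]
      exact congrArg _ (funext fun p => funext fun q => by rw [hκ, hκ]; ring)
    rw [curvTimeTime, h1, hκ, ha, ← hc]
    linear_combination c * spatialGram B y i j * ha'
  have hw : ∀ i j k l, curvSpaceSpace s I N a B i j k l y = -c ^ 2 *
      (spatialGram B y i k * spatialGram B y j l - spatialGram B y j k * spatialGram B y i l) := by
    intro i j k l
    rw [curvSpaceSpace, hN]
    simp only [hκ]
    ring
  have hV : ∀ i j, spaceRicci s I N a f B i j y = -c ^ 2 * spatialGram B y i j := by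
    intro i j
    have h1 : spatialTrace B y (fun p q => curvSpaceSpace s I N a B i p j q y)
        = -c ^ 2 * (spatialGram B y i j * 3 - spatialGram B y i j) := by
      simp only [hw]
      rw [spatialTrace_mul, spatialTrace_sub, tr1]
      congr 2
      rw [← H.spatialTrace_swap hy, ← tr2]
      exact congrArg _ (funext fun p => funext fun q => by rw [hsymm q j]; ring)
    rw [spaceRicci, h1, hA]
    ring
  have hW : scaledScalar s I N a f B y = 0 := by
    rw [scaledScalar]
    simp only [hA, hV]
    ring
  rw [riemannExt, ricciKNExt, scalarKNExt, blockTensor_add_smul, blockTensor_add_smul, ha]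
  refine blockTensor_eq_zero (fun i j => ?_) (fun i j k l => ?_) i j k l
  · simp only [hA, hV, hW]
    rw [tr1]
    ring
  · simp only [hw, hV, hW]
    ring

end Warped

/-! ### The cosmological metric in product charts -/

theorem chartSet_refl_prod {S : Type*} [TopologicalSpace S]
    (e : OpenPartialHomeomorph S (EuclideanSpace ℝ (Fin 3))) (I : Set ℝ) :
    chartSet spacetimeModel ((OpenPartialHomeomorph.refl ℝ).prod e) (I ×ˢ (univ : Set S))
      = I ×ˢ e.target := by
  ext y
  rw [chartSet, OpenPartialHomeomorph.extend_target]
  simp only [OpenPartialHomeomorph.prod_target, OpenPartialHomeomorph.refl_target,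
    ModelWithCorners.range_eq_univ, inter_univ, mem_inter_iff, mem_preimage, mem_prod, mem_univ,
    and_true]
  exact ⟨fun hy => ⟨hy.2, hy.1.2⟩, fun hy => ⟨⟨trivial, hy.2⟩, hy.1⟩⟩

theorem cosmologicalMetric_apply {S : Type*} [TopologicalSpace S]
    [ChartedSpace (EuclideanSpace ℝ (Fin 3)) S] (N a : ℝ → ℝ)
    (h : ℝ → ∀ x : S, TangentSpace (𝓡 3) x →L[ℝ] TangentSpace (𝓡 3) x →L[ℝ] ℝ) (p : ℝ × S)
    (v w : TangentSpace spacetimeModel p) :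
    cosmologicalMetric N a h p v w
      = -(N p.1) ^ 2 * (v.1 * w.1) + (a p.1) ^ 2 * h p.1 p.2 v.2 w.2 := rfl

theorem nondegForm_cosmologicalMetric {S : Type*} [TopologicalSpace S]
    [ChartedSpace (EuclideanSpace ℝ (Fin 3)) S] {I : Set ℝ} {N a : ℝ → ℝ}
    {h : ℝ → ∀ x : S, TangentSpace (𝓡 3) x →L[ℝ] TangentSpace (𝓡 3) x →L[ℝ] ℝ}
    (hh : IsRiemannianFamily I h) {p : ℝ × S} (hp : p.1 ∈ I) (ha : a p.1 ≠ 0) (hN : N p.1 ≠ 0) :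
    NondegForm (cosmologicalMetric N a h p) := by
  intro v hv
  have h1 : v.1 = 0 := by
    have h2 : -(N p.1) ^ 2 * (v.1 * 1) + (a p.1) ^ 2 * h p.1 p.2 v.2 0 = 0 :=
      hv ((1, 0) : E₄)
    simpa [hN] using h2
  have h2 : v.2 = 0 := by
    by_contra hne
    have h3 := hv v
    rw [cosmologicalMetric_apply, h1] at h3
    have := hh.posDef _ hp p.2 v.2 hne
    simp [ha, this.ne'] at h3
  exact Prod.ext h1 h2

section Charts

variable {S : Type*} [TopologicalSpace S] [ChartedSpace (EuclideanSpace ℝ (Fin 3)) S]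
  {e : OpenPartialHomeomorph S (EuclideanSpace ℝ (Fin 3))}

/-- The atlas of `ℝ` as a model space consists of the identity. -/
theorem exists_eq_refl_prod_of_mem_atlas
    {e : OpenPartialHomeomorph (ℝ × S) (ModelProd ℝ (EuclideanSpace ℝ (Fin 3)))}
    (he : e ∈ atlas (ModelProd ℝ (EuclideanSpace ℝ (Fin 3))) (ℝ × S)) :
    ∃ e' ∈ atlas (EuclideanSpace ℝ (Fin 3)) S, e = (OpenPartialHomeomorph.refl ℝ).prod e' := by
  obtain ⟨e₁, he₁, e₂, he₂, rfl⟩ := he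
  rw [chartedSpaceSelf_atlas] at he₁
  exact ⟨e₂, he₂, by rw [he₁]⟩

variable [IsManifold (𝓡 3) ∞ S]

/-- The derivative of the inverse of a product chart is block diagonal. -/
theorem mfderivWithin_extend_symm_refl_prod (he : e ∈ atlas (EuclideanSpace ℝ (Fin 3)) S)
    {y : E₄} (hy : y.2 ∈ e.target) :
    mfderivWithin 𝓘(ℝ, E₄) spacetimeModel
      (((OpenPartialHomeomorph.refl ℝ).prod e).extend spacetimeModel).symm
      (range spacetimeModel) y
      = (ContinuousLinearMap.fst ℝ ℝ (EuclideanSpace ℝ (Fin 3))).prod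
        (ContinuousLinearMap.comp (mfderiv (𝓡 3) (𝓡 3) e.symm y.2 :
            EuclideanSpace ℝ (Fin 3) →L[ℝ] EuclideanSpace ℝ (Fin 3))
          (ContinuousLinearMap.snd ℝ ℝ (EuclideanSpace ℝ (Fin 3)))) := by
  rw [ModelWithCorners.range_eq_univ, mfderivWithin_univ]
  have he' : e.MDifferentiable (𝓡 3) (𝓡 3) := by
    have : IsManifold (𝓡 3) 1 S := IsManifold.of_le (n := ∞) (by simp)
    exact mdifferentiable_of_mem_atlas he
  have h1 : HasMFDerivAt 𝓘(ℝ, E₄) 𝓘(ℝ, ℝ)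
      (fun y : E₄ => y.1) y
      (ContinuousLinearMap.fst ℝ ℝ (EuclideanSpace ℝ (Fin 3))) :=
    (ContinuousLinearMap.fst ℝ ℝ (EuclideanSpace ℝ (Fin 3))).hasMFDerivAt
  have h2 : HasMFDerivAt 𝓘(ℝ, E₄) (𝓡 3)
      (fun y : E₄ => y.2) y
      (ContinuousLinearMap.snd ℝ ℝ (EuclideanSpace ℝ (Fin 3))) :=
    (ContinuousLinearMap.snd ℝ ℝ (EuclideanSpace ℝ (Fin 3))).hasMFDerivAt
  have h3 : HasMFDerivAt (𝓡 3) (𝓡 3) e.symm y.2 (mfderiv (𝓡 3) (𝓡 3) e.symm y.2) :=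
    (he'.mdifferentiableAt_symm hy).hasMFDerivAt
  exact (h1.prodMk (h3.comp y h2)).mfderiv

theorem mfderiv_symm_injective (he : e ∈ atlas (EuclideanSpace ℝ (Fin 3)) S)
    {x : EuclideanSpace ℝ (Fin 3)} (hx : x ∈ e.target) :
    Function.Injective (mfderiv (𝓡 3) (𝓡 3) e.symm x) := by
  have : IsManifold (𝓡 3) 1 S := IsManifold.of_le (n := ∞) (by simp)
  exact (mdifferentiable_of_mem_atlas he).symm.mfderiv_injective hx

variable {I : Set ℝ} {N a f : ℝ → ℝ}
  {h : ℝ → ∀ x : S, TangentSpace (𝓡 3) x →L[ℝ] TangentSpace (𝓡 3) x →L[ℝ] ℝ}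

theorem chartForm_spatialForm_apply (he : e ∈ atlas (EuclideanSpace ℝ (Fin 3)) S)
    {y : E₄} (hy : y.2 ∈ e.target) (v w : E₄) :
    chartForm spacetimeModel ((OpenPartialHomeomorph.refl ℝ).prod e) (spatialForm h) y v w
      = h y.1 (e.symm y.2) (mfderiv (𝓡 3) (𝓡 3) e.symm y.2 v.2)
        (mfderiv (𝓡 3) (𝓡 3) e.symm y.2 w.2) := by
  rw [chartForm, mfderivWithin_extend_symm_refl_prod he hy]
  rfl

theorem chartForm_cosmologicalMetric (he : e ∈ atlas (EuclideanSpace ℝ (Fin 3)) S)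
    {y : E₄} (hy : y.2 ∈ e.target) :
    chartForm spacetimeModel ((OpenPartialHomeomorph.refl ℝ).prod e) (cosmologicalMetric N a h) y
      = (-(N y.1) ^ 2) • (ContinuousLinearMap.fst ℝ ℝ (EuclideanSpace ℝ (Fin 3))).smulRight
          (ContinuousLinearMap.fst ℝ ℝ (EuclideanSpace ℝ (Fin 3)))
        + (a y.1) ^ 2 • chartForm spacetimeModel ((OpenPartialHomeomorph.refl ℝ).prod e)
          (spatialForm h) y := by
  refine ContinuousLinearMap.ext fun v => ContinuousLinearMap.ext fun w => ?_
  rw [chartForm, chartForm, mfderivWithin_extend_symm_refl_prod he hy]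
  rfl

theorem isWarpedOn_chartForm (hI : I.OrdConnected) (hI' : I.Nontrivial)
    (hh : IsRiemannianFamily I h) (ha : ContDiffOn ℝ ∞ a I) (hN : ContDiffOn ℝ ∞ N I)
    (hf : ContDiffOn ℝ ∞ f I) (haf : ∀ t ∈ I, a t = f t * N t)
    (he : e ∈ atlas (EuclideanSpace ℝ (Fin 3)) S) :
    IsWarpedOn (I ×ˢ e.target) I N a f
      (chartForm spacetimeModel ((OpenPartialHomeomorph.refl ℝ).prod e) (cosmologicalMetric N a h))
      (chartForm spacetimeModel ((OpenPartialHomeomorph.refl ℝ).prod e) (spatialForm h)) := by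
  have hId : UniqueDiffOn ℝ I :=
    uniqueDiffOn_convex hI.convex (hI.convex.nontrivial_iff_nonempty_interior.mp hI')
  refine ⟨hId.prod e.open_target.uniqueDiffOn, hId, fun y hy => hy.1, ha, hN, hf, haf, ?_, ?_, ?_,
    ?_, fun y hy => chartForm_cosmologicalMetric he hy.2⟩
  · rw [← chartSet_refl_prod]
    refine hh.smooth _ ⟨OpenPartialHomeomorph.refl ℝ, ?_, e, he, rfl⟩
    rw [chartedSpaceSelf_atlas]
  · intro y hy v w
    rw [chartForm_spatialForm_apply he hy.2, chartForm_spatialForm_apply he hy.2]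
    exact hh.symm _ hy.1 _ _ _
  · intro y hy w
    rw [chartForm_spatialForm_apply he hy.2]
    have h0 : h y.1 (e.symm y.2) (mfderiv (𝓡 3) (𝓡 3) e.symm y.2 0) = 0 := by
      rw [map_zero, map_zero]
    exact congrArg (fun T : TangentSpace (𝓡 3) (e.symm y.2) →L[ℝ] ℝ =>
      T (mfderiv (𝓡 3) (𝓡 3) e.symm y.2 w.2)) h0
  · intro y hy v hv
    rw [chartForm_spatialForm_apply he hy.2]
    refine hh.posDef _ hy.1 _ _ fun h0 => hv ?_
    exact mfderiv_symm_injective he hy.2 (h0.trans (map_zero _).symm)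

end Charts

end

theorem mainTheorem2 {S : Type*} [TopologicalSpace S]
    [ChartedSpace (EuclideanSpace ℝ (Fin 3)) S] [IsManifold (𝓡 3) ∞ S]
    (I : Set ℝ) (hI : I.OrdConnected) (hI' : I.Nontrivial)
    (h : ℝ → ∀ x : S, TangentSpace (𝓡 3) x →L[ℝ] TangentSpace (𝓡 3) x →L[ℝ] ℝ)
    (hh : IsRiemannianFamily I h)
    (a N f : ℝ → ℝ) (ha : ContDiffOn ℝ ∞ a I) (hN : ContDiffOn ℝ ∞ N I)
    (hf : ContDiffOn ℝ ∞ f I) (haf : ∀ t ∈ I, a t = f t * N t)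
    (hdense : I ⊆ closure {t ∈ I | a t ≠ 0}) :
    IsQuasiRegular spacetimeModel spacetimeBasis (I ×ˢ (univ : Set S))
        (cosmologicalMetric N a h) ∧
      ExtendsSmoothly spacetimeModel (I ×ˢ (univ : Set S)) (cosmologicalMetric N a h)
        (ricciKN spacetimeBasis) ∧
      ExtendsSmoothly spacetimeModel (I ×ˢ (univ : Set S)) (cosmologicalMetric N a h)
        (scalarKN spacetimeBasis) ∧
      ExtendsSmoothlyVanishingOn spacetimeModel (I ×ˢ (univ : Set S)) (cosmologicalMetric N a h)
        (weyl spacetimeBasis) {p : ℝ × S | N p.1 = 0} := by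
  have hatlas : ∀ e ∈ atlas (ModelProd ℝ (EuclideanSpace ℝ (Fin 3))) (ℝ × S),
      ∃ e' ∈ atlas (EuclideanSpace ℝ (Fin 3)) S, e = (OpenPartialHomeomorph.refl ℝ).prod e' ∧
      IsWarpedOn (chartSet spacetimeModel e (I ×ˢ (univ : Set S))) I N a f
        (chartForm spacetimeModel e (cosmologicalMetric N a h))
        (chartForm spacetimeModel e (spatialForm h)) := by
    intro e he
    obtain ⟨e', he', rfl⟩ := exists_eq_refl_prod_of_mem_atlas he
    refine ⟨e', he', rfl, ?_⟩
    rw [chartSet_refl_prod]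
    exact isWarpedOn_chartForm hI hI' hh ha hN hf haf he'
  have hD : ∀ V : Set (EuclideanSpace ℝ (Fin 3)),
      I ×ˢ V ⊆ closure {y ∈ I ×ˢ V | a y.1 ≠ 0} := by
    intro V y hy
    have h1 : y ∈ closure ({t ∈ I | a t ≠ 0} ×ˢ V) := by
      rw [closure_prod_eq]
      exact ⟨hdense hy.1, subset_closure hy.2⟩
    have h2 : {t ∈ I | a t ≠ 0} ×ˢ V ⊆ {y ∈ I ×ˢ V | a y.1 ≠ 0} :=
      fun z hz => ⟨⟨hz.1.1, hz.2⟩, hz.1.2⟩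
    exact closure_mono h2 h1
  refine ⟨⟨⟨?_, ?_, ?_, ?_⟩, ?_, ?_, ?_⟩, ?_, ?_, ?_⟩
  · intro e he
    obtain ⟨e', -, -, H⟩ := hatlas e he
    exact H.contDiffOn_G
  · intro p hp v w
    rw [cosmologicalMetric_apply, cosmologicalMetric_apply, hh.symm p.1 hp.1 p.2 v.2 w.2,
      mul_comm v.1]
  · intro e he
    obtain ⟨e', -, -, H⟩ := hatlas e he
    exact H.radicalStationary
  · intro e he
    obtain ⟨e', -, rfl, H⟩ := hatlas e he
    refine H.smoothKoszulContraction ?_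
    rw [chartSet_refl_prod]
    exact hD _
  · intro p hp
    have h1 : p ∈ closure ({t ∈ I | a t ≠ 0} ×ˢ (univ : Set S)) := by
      rw [closure_prod_eq]
      exact ⟨hdense hp.1, subset_closure hp.2⟩
    have h2 : {t ∈ I | a t ≠ 0} ×ˢ (univ : Set S)
        ⊆ {p ∈ I ×ˢ (univ : Set S) | NondegForm (cosmologicalMetric N a h p)} :=
      fun q hq => ⟨⟨hq.1.1, trivial⟩, nondegForm_cosmologicalMetric hh hq.1.1 hq.1.2
        fun h0 => hq.1.2 (by rw [haf _ hq.1.1, h0, mul_zero])⟩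
    exact closure_mono h2 h1
  · intro e he i j k l
    obtain ⟨e', -, -, H⟩ := hatlas e he
    refine ⟨_, (contDiffOn_const (c := 1 / 24)).mul (H.contDiffOn_scalarKNExt i j k l),
      fun y hy hnd => ?_⟩
    rw [scalarPart_eq_scalarKN, H.scalarKN_eq hy ((H.nondegForm_iff hy).mp hnd)]
  · intro e he i j k l
    obtain ⟨e', -, -, H⟩ := hatlas e he
    refine ⟨_, ((contDiffOn_const (c := 1 / 2)).mul (H.contDiffOn_ricciKNExt i j k l)).sub
      ((contDiffOn_const (c := 1 / 8)).mul (H.contDiffOn_scalarKNExt i j k l)), fun y hy hnd => ?_⟩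
    have hne := (H.nondegForm_iff hy).mp hnd
    rw [semiTracelessPart_eq, H.scalarKN_eq hy hne, H.ricciKN_eq hy hne]
  · intro e he i j k l
    obtain ⟨e', -, -, H⟩ := hatlas e he
    exact ⟨_, H.contDiffOn_ricciKNExt i j k l, fun y hy hnd =>
      (H.ricciKN_eq hy ((H.nondegForm_iff hy).mp hnd) i j k l).symm⟩
  · intro e he i j k l
    obtain ⟨e', -, -, H⟩ := hatlas e he
    exact ⟨_, H.contDiffOn_scalarKNExt i j k l, fun y hy hnd =>
      (H.scalarKN_eq hy ((H.nondegForm_iff hy).mp hnd) i j k l).symm⟩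
  · intro e he i j k l
    obtain ⟨e', -, rfl, H⟩ := hatlas e he
    refine ⟨_, ((H.contDiffOn_riemannExt i j k l).add
      ((contDiffOn_const (c := -(1 / 2))).mul (H.contDiffOn_ricciKNExt i j k l))).add
      ((contDiffOn_const (c := 1 / 12)).mul (H.contDiffOn_scalarKNExt i j k l)), fun y hy hnd => ?_,
      fun y hy hNy => H.weylExt_eq_zero hy hNy i j k l⟩
    have hne := (H.nondegForm_iff hy).mp hnd
    rw [weyl_eq, H.riemann_eq_blockTensor hy hne, H.ricciKN_eq hy hne, H.scalarKN_eq hy hne]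
    rfl
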